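/- Let $\mathcal A,\mathcal S,\mathcal S_e,\mathcal S_d,\mathcal X,\mathcal Y$ be finite alphabets ($\mathcal X\neq\emptyset$), and let $P_S$, $P_{S_e|S,A}$, $P_{S_d|S,S_e,A}$, $P_{Y|X,S}$ be given probability laws, $\Lambda:\mathcal A\to\mathbb R$ a cost function and $\Gamma\in\mathbb R$ with $\Lambda(a)\le\Gamma$ for at least one $a\in\mathcal A$. A code of block length $n$ with $M$ messages consists of action sequences $A^n(m)\in\mathcal A^n$, causal encoders $X_i=f_{e,i}(m,S_{e,1},\dots,S_{e,i})$ and a decoder $\hat m=f_d(Y^n,S_d^n)$. The message is uniform, the states are i.i.d. $\sim P_S$ and independent of the message, and $S_{e,i}$, $S_{d,i}$, $Y_i$ are generated memorylessly from $P_{S_e|S,A}$, $P_{S_d|S,S_e,A}$, $P_{Y|X,S}$. A rate $R$ is achievable if there are codes with at least $2^{nR}$ messages such that $\frac1n\sum_{i=1}^n\Lambda(A_i(m))\le\Gamma$ for every message $m$ and all sufficiently large $n$, and the probability of decoding error tends to $0$ as $n\to\infty$. The causal probing capacity $C_c(\Gamma)$ is the supremum of the achievable rates. Then $C_c(\Gamma)$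 is finite and $$C_c(\Gamma)=\max I(U;Y,S_d)\quad\text{(in bits)},$$ where the maximum is attained and is over all joint laws $$P_U\,\mathbf 1_{\{A=g(U)\}}\,P_S\,P_{S_e|S,A}\,P_{S_d|S,S_e,A}\,\mathbf 1_{\{X=f(U,S_e)\}}\,P_{Y|X,S}$$ (for some $P_U,g,f$) with $E[\Lambda(A)]\le\Gamma$ and $$|\mathcal U|\le\min\{|\mathcal Y||\mathcal S_d|+1,\ |\mathcal A||\mathcal S||\mathcal S_e||\mathcal S_d||\mathcal X|+3\}.$$ If moreover $\Lambda(a)\le\Gamma$ for all $a\in\mathcal A$ (the cost constraint is void), the same holds with $|\mathcal U|\le\min\{|\mathcal Y||\mathcal S_d|,\ |\mathcal A||\mathcal S||\mathcal S_e||\mathcal S_d||\mathcal X|+3\}.$ -/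

import Mathlib

open Filter Topology

namespace Probing

/-- The laws given by nature, on finite alphabets: the state law `P_S`, the law `P_{S_e|S,A}` of the
encoder's observation, the law `P_{S_d|S,S_e,A}` of the decoder's observation and the channel
`P_{Y|X,S}`. Each law is a probability mass function, i.e. a point of a standard simplex. -/
structure Model (A S Se Sd X Y : Type*) [Fintype S] [Fintype Se] [Fintype Sd] [Fintype Y] where
  /-- `P_S(s)` -/
  state : S → ℝ
  state_mem : state ∈ stdSimplex ℝ S
  /-- `P_{S_e|S,A}(s_e | s, a)` is `encObs s a s_e` -/
  encObs : S → A → Se → ℝ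
  encObs_mem : ∀ s a, encObs s a ∈ stdSimplex ℝ Se
  /-- `P_{S_d|S,S_e,A}(s_d | s, s_e, a)` is `decObs s s_e a s_d` -/
  decObs : S → Se → A → Sd → ℝ
  decObs_mem : ∀ s se a, decObs s se a ∈ stdSimplex ℝ Sd
  /-- `P_{Y|X,S}(y | x, s)` is `channel x s y` -/
  channel : X → S → Y → ℝ
  channel_mem : ∀ x s, channel x s ∈ stdSimplex ℝ Y

/-- A code of block length `n` for `M` messages, with message-dependent actions and causal
encoding: the `i`-th channel input is a function of the message and of the observations
`S_{e,1}, …, S_{e,i}`. -/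
structure Code (A Se Sd X Y : Type*) (n M : ℕ) where
  /-- the action sequence `A^n(m)` -/
  action : Fin M → Fin n → A
  /-- `X_i = f_{e,i}(m, S_e^i)` -/
  encode : Fin M → (i : Fin n) → (Set.Iic i → Se) → X
  /-- the message estimate from `(Y^n, S_d^n)` -/
  decode : (Fin n → Y) → (Fin n → Sd) → Fin M

section

variable {A S Se Sd X Y : Type*} [Fintype S] [Fintype Se] [Fintype Sd] [Fintype Y]

/-- Every codeword of actions has average cost `(1/n) ∑ Λ(A_i)` at most `Γ`. -/
def Code.MeetsCost {n M : ℕ} (c : Code A Se Sd X Y n M) (Λ : A → ℝ) (Γ : ℝ) : Prop :=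
  ∀ m : Fin M, (1 / (n : ℝ)) * ∑ i, Λ (c.action m i) ≤ Γ

/-- The joint law of the message and of `(S^n, S_e^n, S_d^n, Y^n)` induced by a code, for a uniform
message and an i.i.d. state sequence independent of it; the sequences `A^n` and `X^n` are the ones
that the code produces. -/
noncomputable def Model.codeLaw (W : Model A S Se Sd X Y) {n M : ℕ} (c : Code A Se Sd X Y n M)
    (m : Fin M) (s : Fin n → S) (se : Fin n → Se) (sd : Fin n → Sd) (y : Fin n → Y) : ℝ :=
  (1 / (M : ℝ)) * ∏ i, W.state (s i) * W.encObs (s i) (c.action m i) (se i) *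
    W.decObs (s i) (se i) (c.action m i) (sd i) *
    W.channel (c.encode m i fun j => se j) (s i) (y i)

/-- The probability that the decoded message differs from the message. -/
noncomputable def Model.errorProb (W : Model A S Se Sd X Y) {n M : ℕ}
    (c : Code A Se Sd X Y n M) : ℝ :=
  ∑ m, ∑ s, ∑ se, ∑ sd, ∑ y, if c.decode y sd = m then 0 else W.codeLaw c m s se sd y

/-- `R` (in bits per channel use) is achievable under the cost constraint `Γ`: there are codes with
at least `2 ^ (n R)` messages that meet the cost constraint, with error probability tending to
`0` as the block length `n` grows. -/
def Model.Achievable (W : Model A S Se Sd X Y) (Λ : A → ℝ) (Γ R : ℝ) : Prop :=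
  ∃ (M : ℕ → ℕ) (c : ∀ n, Code A Se Sd X Y n (M n)),
    (∀ᶠ n : ℕ in atTop, (2 : ℝ) ^ ((n : ℝ) * R) ≤ (M n : ℝ) ∧ (c n).MeetsCost Λ Γ) ∧
    Tendsto (fun n => W.errorProb (c n)) atTop (𝓝 0)

/-- `C` is the causal probing capacity: the supremum of the achievable rates. -/
def Model.IsCausalCapacity (W : Model A S Se Sd X Y) (Λ : A → ℝ) (Γ C : ℝ) : Prop :=
  IsLUB {R : ℝ | W.Achievable Λ Γ R} C

/-- Mutual information, in bits, of a pair with joint probability mass function `p`. -/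
noncomputable def mutualInfo {α β : Type*} [Fintype α] [Fintype β] (p : α → β → ℝ) : ℝ :=
  ∑ a, ∑ b, p a b * Real.logb 2 (p a b / ((∑ b', p a b') * ∑ a', p a' b))

variable [DecidableEq A] [DecidableEq X]

/-- The joint law
`P_U 1{A = g(U)} P_S P_{S_e|S,A} P_{S_d|S,S_e,A} 1{X = f(U,S_e)} P_{Y|X,S}`. -/
def Model.jointLaw (W : Model A S Se Sd X Y) {U : Type*} (pU : U → ℝ) (g : U → A)
    (f : U → Se → X) (u : U) (a : A) (s : S) (se : Se) (sd : Sd) (x : X) (y : Y) : ℝ :=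
  pU u * (if a = g u then 1 else 0) * W.state s * W.encObs s a se * W.decObs s se a sd *
    (if x = f u se then 1 else 0) * W.channel x s y

variable [Fintype A] [Fintype X]

/-- `E[Λ(A)]` under the joint law. -/
def Model.expectedCost (W : Model A S Se Sd X Y) (Λ : A → ℝ) {U : Type*} [Fintype U]
    (pU : U → ℝ) (g : U → A) (f : U → Se → X) : ℝ :=
  ∑ u, ∑ a, ∑ s, ∑ se, ∑ sd, ∑ x, ∑ y, W.jointLaw pU g f u a s se sd x y * Λ a

/-- `I(U; Y, S_d)` under the joint law. -/
noncomputable def Model.information (W : Model A S Se Sd X Y) {U : Type*} [Fintype U]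
    (pU : U → ℝ) (g : U → A) (f : U → Se → X) : ℝ :=
  mutualInfo fun (u : U) (v : Y × Sd) =>
    ∑ a, ∑ s, ∑ se, ∑ x, W.jointLaw pU g f u a s se v.2 x v.1

/-- The values of `I(U; Y, S_d)` over all `P_U`, `g`, `f` with `E[Λ(A)] ≤ Γ`, where the alphabet of
`U` has at most `N` elements. -/
def Model.informationValues (W : Model A S Se Sd X Y) (Λ : A → ℝ) (Γ : ℝ) (N : ℕ) : Set ℝ :=
  {I | ∃ k : ℕ, k ≤ N ∧ ∃ pU ∈ stdSimplex ℝ (Fin k), ∃ (g : Fin k → A) (f : Fin k → Se → X),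
    W.expectedCost Λ pU g f ≤ Γ ∧ W.information pU g f = I}

end

end Probing

/-!
The pair `t = (a, f)` of an action and a map `f : Se → X` from the present observation to the
channel input is a Shannon strategy. Summing out the states turns the model into a memoryless
channel `Model.strategyChannel` from strategies to `(Y, S_d)`, and `I(U; Y, S_d)` depends only on
the law of the strategy `(g(U), f(U, ·))`; so the problem is the capacity of a finite memoryless
channel, with a cost on the letters, whose encoder has causal side information.

Attainment: `channelInfo` is continuous on the compact set of admissible laws of the strategy. For
the alphabet bounds, fix the values of finitely many linear functionals that determine the law of
`(Y, S_d)` and the cost. On that polytope the information is linear, so it is maximized by a law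
with at most as many atoms as there are functionals (`exists_small_support`). The functionals are
the law of `(Y, S_d)`, with the cost added unless it is void, or alternatively the law of `(A, S, S_e, S_d, X)`.

Achievability: a code may fix one strategy per letter. Feinstein's maximal code lemma
(`exists_maximal_code`), restricted to the words that meet the cost constraint, needs only that
the information density of independent letters concentrates and that the constraint is violated
with vanishing probability. The latter is the law of large numbers when the mean cost is below
`Γ`, which is arranged by mixing in a cheap strategy; if no action is cheaper than `Γ`, every
action in use costs exactly `Γ`.

Converse (`correct_mul_log_le`): given the message and the past, a causal code selects a strategy
for each time. Let `q` be the output law of the average law `p` of these strategies. The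
likelihood ratio of a path against independent outputs of law `q` has mean logarithm exactly `n`
times `channelInfo p`, and changing the measure by it makes the outputs (sub)distributed as `q^n`
whatever the message, so that the correct message is then decoded with probability at most
`1 / M`. Gibbs' inequality gives `P(correct) log M ≤ n * channelInfo p + 1`, with `p` admissible; no
entropy chain rule and no concavity of the information is needed.
-/

namespace Probing

/-! ### Information of a finite channel -/

section ChannelInformation

variable {T V U : Type*} [Fintype T] [Fintype U]

/-- The law of the output of the channel `Q` when its input has law `p`. -/
def outputLaw (Q : T → V → ℝ) (p : T → ℝ) (v : V) : ℝ := ∑ t, p t * Q t v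

lemma outputLaw_nonneg {Q : T → V → ℝ} {p : T → ℝ} (hQ : ∀ t v, 0 ≤ Q t v) (hp : ∀ t, 0 ≤ p t)
    (v : V) : 0 ≤ outputLaw Q p v :=
  Finset.sum_nonneg fun t _ => mul_nonneg (hp t) (hQ t v)

lemma outputLaw_pos {Q : T → V → ℝ} {p : T → ℝ} (hQ : ∀ t v, 0 ≤ Q t v) (hp : ∀ t, 0 ≤ p t)
    {t : T} {v : V} (ht : 0 < p t) (hv : 0 < Q t v) : 0 < outputLaw Q p v :=
  (mul_pos ht hv).trans_le
    (Finset.single_le_sum (f := fun t => p t * Q t v)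
      (fun t _ => mul_nonneg (hp t) (hQ t v)) (Finset.mem_univ t))

variable [Fintype V]

/-- The relative entropy `D(r ‖ q)` in bits, for `r` absolutely continuous with respect to `q`. -/
noncomputable def divergence (r q : V → ℝ) : ℝ := ∑ v, r v * Real.logb 2 (r v / q v)

/-- The mutual information, in bits, between the input and the output of the channel `Q` when the
input has law `p`, written as an average of divergences from the output law. -/
noncomputable def channelInfo (Q : T → V → ℝ) (p : T → ℝ) : ℝ :=
  ∑ t, p t * divergence (Q t) (outputLaw Q p)

lemma sum_outputLaw {Q : T → V → ℝ} {p : T → ℝ} (hQ : ∀ t, ∑ v, Q t v = 1) :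
    ∑ v, outputLaw Q p v = ∑ t, p t := by
  simp only [outputLaw]
  rw [Finset.sum_comm]
  simp [← Finset.mul_sum, hQ]

lemma mutualInfo_eq_channelInfo {Q : T → V → ℝ} (p : T → ℝ) (hQ : ∀ t, ∑ v, Q t v = 1) :
    mutualInfo (fun t v => p t * Q t v) = channelInfo Q p := by
  simp only [mutualInfo, channelInfo, divergence]
  refine Finset.sum_congr rfl fun t _ => ?_
  rw [Finset.mul_sum]
  refine Finset.sum_congr rfl fun v _ => ?_
  rw [← Finset.mul_sum, hQ, mul_one, ← mul_assoc]
  rcases eq_or_ne (p t) 0 with h | h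
  · simp [h]
  · rw [mul_div_mul_left _ _ h]
    rfl

/-- Mutual information as the entropy of the output minus its conditional entropy given the input.
Once the output law is fixed, the information is thus linear in the input law. -/
lemma channelInfo_eq_entropy {Q : T → V → ℝ} {p : T → ℝ} (hQ : ∀ t v, 0 ≤ Q t v)
    (hp : ∀ t, 0 ≤ p t) :
    channelInfo Q p = (∑ v, Real.negMulLog (outputLaw Q p v)
      - ∑ t, p t * ∑ v, Real.negMulLog (Q t v)) / Real.log 2 := by
  have key : ∀ t v, p t * (Q t v * Real.logb 2 (Q t v / outputLaw Q p v)) =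
      (p t * Q t v * -Real.log (outputLaw Q p v) - p t * Real.negMulLog (Q t v))
        / Real.log 2 := by
    intro t v
    rcases (hp t).eq_or_lt with h | h
    · simp [← h]
    rcases (hQ t v).eq_or_lt with h' | h'
    · simp [← h']
    rw [Real.logb, Real.log_div h'.ne' (outputLaw_pos hQ hp h h').ne', Real.negMulLog]
    ring
  simp only [channelInfo, divergence, Finset.mul_sum, key]
  simp only [← Finset.sum_div, Finset.sum_sub_distrib]
  congr 2
  rw [Finset.sum_comm]
  refine Finset.sum_congr rfl fun v _ => ?_
  rw [← Finset.sum_mul, Real.negMulLog, outputLaw]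
  ring

lemma continuousOn_channelInfo {Q : T → V → ℝ} (hQ : ∀ t v, 0 ≤ Q t v) :
    ContinuousOn (channelInfo Q) {p | ∀ t, 0 ≤ p t} := by
  have : Continuous fun p : T → ℝ => (∑ v, Real.negMulLog (outputLaw Q p v)
      - ∑ t, p t * ∑ v, Real.negMulLog (Q t v)) / Real.log 2 := by
    unfold outputLaw
    fun_prop
  exact this.continuousOn.congr fun p hp => channelInfo_eq_entropy hQ hp

/-- The law of `τ` under `p`. -/
def pushLaw [DecidableEq T] (τ : U → T) (p : U → ℝ) (t : T) : ℝ := ∑ u, if τ u = t then p u else 0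

lemma sum_pushLaw_mul [DecidableEq T] (τ : U → T) (p : U → ℝ) (w : T → ℝ) :
    ∑ t, pushLaw τ p t * w t = ∑ u, p u * w (τ u) := by
  simp only [pushLaw, Finset.sum_mul]
  rw [Finset.sum_comm]
  simp [ite_mul]

lemma pushLaw_mem_stdSimplex [DecidableEq T] (τ : U → T) {p : U → ℝ} (hp : p ∈ stdSimplex ℝ U) :
    pushLaw τ p ∈ stdSimplex ℝ T := by
  refine ⟨fun t => Finset.sum_nonneg fun u _ => ?_, ?_⟩
  · split_ifs
    exacts [hp.1 u, le_rfl]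
  · simpa [hp.2] using sum_pushLaw_mul τ p 1

lemma channelInfo_pushLaw [DecidableEq T] (Q : T → V → ℝ) (τ : U → T) (p : U → ℝ) :
    channelInfo Q (pushLaw τ p) = channelInfo (fun u => Q (τ u)) p := by
  have h : outputLaw Q (pushLaw τ p) = outputLaw (fun u => Q (τ u)) p := by
    funext v
    exact sum_pushLaw_mul τ p fun t => Q t v
  rw [channelInfo, sum_pushLaw_mul, h, channelInfo]

end ChannelInformation

/-! ### Laws with few atoms -/

section SupportReduction

variable {T κ : Type*} [Fintype T] [Fintype κ]

/-- One step towards a vertex of the polytope of laws with prescribed values of the linear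
functionals `ℓ`: unless there are at most `card κ` atoms, the mass can be moved along a direction
that `ℓ` does not see, without decreasing the linear functional `w`, until an atom disappears. -/
lemma exists_smaller_support [DecidableEq T] (ℓ : T → κ → ℝ) (w : T → ℝ)
    (hℓ : ∀ d : T → ℝ, (∀ c, ∑ t, d t * ℓ t c = 0) → ∑ t, d t = 0)
    {p : T → ℝ} (hp : ∀ t, 0 ≤ p t)
    (hcard : Fintype.card κ < (Finset.univ.filter fun t => p t ≠ 0).card) :
    ∃ p' : T → ℝ, (∀ t, 0 ≤ p' t) ∧ (∀ c, ∑ t, p' t * ℓ t c = ∑ t, p t * ℓ t c) ∧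
      ∑ t, p t * w t ≤ ∑ t, p' t * w t ∧
      (Finset.univ.filter fun t => p' t ≠ 0).card < (Finset.univ.filter fun t => p t ≠ 0).card := by
  set s := Finset.univ.filter fun t => p t ≠ 0 with hs
  -- more vectors than dimensions: a linear relation among the `ℓ t` for `t` in the support
  obtain ⟨d, hd, hds, hd0⟩ : ∃ d : T → ℝ, (∀ c, ∑ t, d t * ℓ t c = 0) ∧ (∀ t, p t = 0 → d t = 0) ∧
      ∃ t, d t ≠ 0 := by
    have hdep : ¬ LinearIndependent ℝ fun t : s => ℓ t := by
      intro h
      have := h.fintype_card_le_finrank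
      simp only [Module.finrank_fintype_fun_eq_card, Fintype.card_coe] at this
      omega
    obtain ⟨g, hg, i, hi⟩ := Fintype.not_linearIndependent_iff.1 hdep
    refine ⟨fun t => if h : t ∈ s then g ⟨t, h⟩ else 0, fun c => ?_, fun t ht => ?_, i, ?_⟩
    · have := congrFun hg c
      simp only [Finset.sum_apply, Pi.smul_apply, smul_eq_mul, Pi.zero_apply] at this
      refine Eq.trans ?_ this
      rw [← Finset.sum_subset (Finset.subset_univ s), ← Finset.sum_coe_sort]
      · refine Finset.sum_congr rfl fun t _ => ?_
        simp
      · intro t _ ht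
        simp [ht]
    · have : t ∉ s := by simp [hs, ht]
      simp [this]
    · simpa using hi
  wlog hw : 0 ≤ ∑ t, d t * w t generalizing d
  · refine this (-d) (fun c => ?_) (fun t ht => ?_) ?_ ?_
    · simp [hd c]
    · simp [hds t ht]
    · obtain ⟨t, ht⟩ := hd0
      exact ⟨t, by simpa using ht⟩
    · simp only [Pi.neg_apply, neg_mul, Finset.sum_neg_distrib]
      linarith
  obtain ⟨t₀, ht₀⟩ : ∃ t, d t < 0 := by
    by_contra! hcon
    obtain ⟨t, ht⟩ := hd0
    exact ht ((Finset.sum_eq_zero_iff_of_nonneg fun t _ => hcon t).1 (hℓ d hd) t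
      (Finset.mem_univ t))
  -- the first atom that vanishes on the way
  obtain ⟨t₁, ht₁, hmin⟩ := Finset.exists_min_image (Finset.univ.filter fun t => d t < 0)
    (fun t => p t / -d t) ⟨t₀, by simpa using ht₀⟩
  simp only [Finset.mem_filter, Finset.mem_univ, true_and] at ht₁ hmin
  set ε := p t₁ / -d t₁ with hε
  have hε0 : 0 ≤ ε := div_nonneg (hp t₁) (by linarith)
  have hlin : ∀ z : T → ℝ, ∑ t, (p t + ε * d t) * z t = ∑ t, p t * z t + ε * ∑ t, d t * z t := by
    intro z
    rw [Finset.mul_sum, ← Finset.sum_add_distrib]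
    exact Finset.sum_congr rfl fun t _ => by ring
  refine ⟨fun t => p t + ε * d t, fun t => ?_, fun c => ?_, ?_, ?_⟩
  · rcases lt_or_ge (d t) 0 with h | h
    · have := (le_div_iff₀ (by linarith : 0 < -d t)).1 (hmin t h)
      dsimp only
      linarith
    · exact add_nonneg (hp t) (mul_nonneg hε0 h)
  · rw [hlin, hd c, mul_zero, add_zero]
  · rw [hlin]
    linarith [mul_nonneg hε0 hw]
  · refine Finset.card_lt_card ⟨fun t ht => ?_, fun hsub => ?_⟩
    · simp only [hs, Finset.mem_filter, Finset.mem_univ, true_and] at ht ⊢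
      intro h
      exact ht (by simp [h, hds t h])
    · have h1 : t₁ ∈ s := by
        simp only [hs, Finset.mem_filter, Finset.mem_univ, true_and]
        intro h
        exact ht₁.ne (hds t₁ h)
      have h2 := hsub h1
      simp only [Finset.mem_filter, Finset.mem_univ, true_and] at h2
      apply h2
      rw [hε]
      field_simp [ht₁.ne]
      ring

/-- Linear programming form of the support lemma: a linear functional is maximized, given the values
of `card κ` others, by a law with at most `card κ` atoms. -/
lemma exists_small_support [DecidableEq T] (ℓ : T → κ → ℝ) (w : T → ℝ)
    (hℓ : ∀ d : T → ℝ, (∀ c, ∑ t, d t * ℓ t c = 0) → ∑ t, d t = 0)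
    {p : T → ℝ} (hp : ∀ t, 0 ≤ p t) :
    ∃ p' : T → ℝ, (∀ t, 0 ≤ p' t) ∧ (∀ c, ∑ t, p' t * ℓ t c = ∑ t, p t * ℓ t c) ∧
      ∑ t, p t * w t ≤ ∑ t, p' t * w t ∧
      (Finset.univ.filter fun t => p' t ≠ 0).card ≤ Fintype.card κ := by
  induction hN : (Finset.univ.filter fun t => p t ≠ 0).card using Nat.strong_induction_on
    generalizing p with
  | _ N ih =>
    by_cases h : N ≤ Fintype.card κ
    · exact ⟨p, hp, fun _ => rfl, le_rfl, hN ▸ h⟩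
    · obtain ⟨p₁, h1, h2, h3, h4⟩ := exists_smaller_support ℓ w hℓ hp (by omega)
      obtain ⟨p₂, g1, g2, g3, g4⟩ := ih _ (hN ▸ h4) h1 rfl
      exact ⟨p₂, g1, fun c => (g2 c).trans (h2 c), h3.trans g3, g4⟩

end SupportReduction

/-! ### Maximal codes -/

section MaximalCode

variable {α β : Type*} [Fintype α] [Fintype β]

/-- Feinstein's maximal code lemma: `B x` is the set of outputs `v` with `a q(v) < Q(v|x)`, where
`q` is the output law of `P`. As long as the joint law gives the event `x ∈ F, v ∈ B x` a mass
above `1 - ε + M / a`, a code with fewer than `M` codewords in `F`, decoding sets inside the `B x`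
and error at most `ε` can be enlarged. -/
theorem exists_maximal_code [DecidableEq β] {P : α → ℝ} {Q : α → β → ℝ}
    (hP : P ∈ stdSimplex ℝ α) (hQ : ∀ x, Q x ∈ stdSimplex ℝ β) (F : Finset α) {a ε : ℝ}
    (ha : 0 < a) (hε : ε ≤ 1) (M : ℕ)
    (h : 1 - ε + M / a < ∑ x ∈ F, P x *
      ∑ v ∈ Finset.univ.filter (fun v => a * outputLaw Q P v < Q x v), Q x v) :
    ∃ (x : Fin M → α) (D : Fin M → Finset β), (∀ m, x m ∈ F) ∧
      (∀ m m', m ≠ m' → Disjoint (D m) (D m')) ∧ ∀ m, 1 - ε ≤ ∑ v ∈ D m, Q (x m) v := by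
  set B : α → Finset β :=
    fun x => Finset.univ.filter (fun v => a * outputLaw Q P v < Q x v) with hB
  have hq : ∀ v, 0 ≤ outputLaw Q P v := outputLaw_nonneg (fun x => (hQ x).1) hP.1
  have hqB : ∀ x, ∑ v ∈ B x, outputLaw Q P v ≤ 1 / a := by
    intro x
    rw [le_div_iff₀ ha, Finset.sum_mul]
    calc ∑ v ∈ B x, outputLaw Q P v * a ≤ ∑ v ∈ B x, Q x v := by
          refine Finset.sum_le_sum fun v hv => ?_
          simp only [hB, Finset.mem_filter] at hv
          linarith [hv.2]
      _ ≤ ∑ v, Q x v := Finset.sum_le_sum_of_subset_of_nonneg (Finset.subset_univ _)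
          fun v _ _ => (hQ x).1 v
      _ = 1 := (hQ x).2
  suffices hk : ∀ k ≤ M, ∃ (x : Fin k → α) (D : Fin k → Finset β), (∀ m, x m ∈ F) ∧
      (∀ m m', m ≠ m' → Disjoint (D m) (D m')) ∧ (∀ m, D m ⊆ B (x m)) ∧
      ∀ m, 1 - ε ≤ ∑ v ∈ D m, Q (x m) v by
    obtain ⟨x, D, h1, h2, -, h3⟩ := hk M le_rfl
    exact ⟨x, D, h1, h2, h3⟩
  intro k
  induction k with
  | zero => exact fun _ => ⟨Fin.elim0, Fin.elim0, fun m => m.elim0, fun m => m.elim0,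
      fun m => m.elim0, fun m => m.elim0⟩
  | succ k ih =>
    intro hk
    obtain ⟨x, D, h1, h2, h3, h4⟩ := ih (by omega)
    set E : Finset β := Finset.univ.biUnion D with hE
    have hqE : ∑ v ∈ E, outputLaw Q P v ≤ k / a := by
      calc ∑ v ∈ E, outputLaw Q P v ≤ ∑ m, ∑ v ∈ D m, outputLaw Q P v := by
            rw [hE, Finset.sum_biUnion fun m _ m' _ hmm => h2 m m' hmm]
        _ ≤ ∑ _m : Fin k, 1 / a := Finset.sum_le_sum fun m _ =>
            (Finset.sum_le_sum_of_subset_of_nonneg (h3 m) fun v _ _ => hq v).trans (hqB _)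
        _ = k / a := by simp [div_eq_mul_inv]
    obtain ⟨x₀, hx₀F, hx₀⟩ : ∃ x₀ ∈ F, 1 - ε ≤ ∑ v ∈ B x₀ \ E, Q x₀ v := by
      by_contra! hcon
      have hkM : (k : ℝ) / a ≤ M / a := by
        gcongr
        omega
      have hsub : ∀ x, ∑ v ∈ B x, Q x v ≤ ∑ v ∈ B x \ E, Q x v + ∑ v ∈ E, Q x v := by
        intro x
        rw [← Finset.sum_union Finset.sdiff_disjoint]
        exact Finset.sum_le_sum_of_subset_of_nonneg (by simp) fun v _ _ => (hQ x).1 v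
      have : ∑ x ∈ F, P x * ∑ v ∈ B x, Q x v ≤ 1 - ε + M / a := by
        calc ∑ x ∈ F, P x * ∑ v ∈ B x, Q x v
            ≤ ∑ x ∈ F, (P x * (1 - ε) + P x * ∑ v ∈ E, Q x v) := by
              refine Finset.sum_le_sum fun x hx => ?_
              rw [← mul_add]
              exact mul_le_mul_of_nonneg_left ((hsub x).trans (by linarith [hcon x hx])) (hP.1 x)
          _ ≤ ∑ x, (P x * (1 - ε) + P x * ∑ v ∈ E, Q x v) := by
              refine Finset.sum_le_sum_of_subset_of_nonneg (Finset.subset_univ _) fun x _ _ => ?_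
              exact add_nonneg (mul_nonneg (hP.1 x) (by linarith))
                (mul_nonneg (hP.1 x) (Finset.sum_nonneg fun v _ => (hQ x).1 v))
          _ = 1 - ε + ∑ v ∈ E, outputLaw Q P v := by
              rw [Finset.sum_add_distrib, ← Finset.sum_mul, hP.2, one_mul]
              simp only [outputLaw, Finset.mul_sum]
              rw [Finset.sum_comm]
          _ ≤ 1 - ε + M / a := by linarith
      linarith
    have hdis : ∀ m, Disjoint (B x₀ \ E) (D m) := fun m =>
      Finset.disjoint_of_subset_right (Finset.subset_biUnion_of_mem D (Finset.mem_univ m))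
        Finset.sdiff_disjoint
    refine ⟨Fin.cons x₀ x, Fin.cons (B x₀ \ E) D, fun m => ?_, fun m m' hmm => ?_, fun m => ?_,
      fun m => ?_⟩
    · cases m using Fin.cases with
      | zero => exact hx₀F
      | succ m => exact h1 m
    · cases m using Fin.cases with
      | zero =>
        cases m' using Fin.cases with
        | zero => exact absurd rfl hmm
        | succ m' => exact hdis m'
      | succ m =>
        cases m' using Fin.cases with
        | zero => exact (hdis m).symm
        | succ m' => exact h2 m m' fun h => hmm (by rw [h])
    · cases m using Fin.cases with
      | zero => exact Finset.sdiff_subset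
      | succ m => exact h3 m
    · cases m using Fin.cases with
      | zero => exact hx₀
      | succ m => exact h4 m

end MaximalCode

/-! ### The weak law of large numbers on a finite alphabet -/

section WeakLaw

variable {Z : Type*} [Fintype Z]

lemma sum_prod_eq_prod_sum {n : ℕ} (f : Fin n → Z → ℝ) :
    ∑ z : Fin n → Z, ∏ i, f i (z i) = ∏ i, ∑ z, f i z := by
  classical
  rw [← Fintype.piFinset_univ, ← Finset.prod_univ_sum]

lemma sum_prod_eq_one {p : Z → ℝ} (hp : ∑ z, p z = 1) (n : ℕ) :
    ∑ z : Fin n → Z, ∏ i, p (z i) = 1 := by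
  simp [sum_prod_eq_prod_sum fun (_ : Fin n) => p, hp]

lemma sum_fin_cons {n : ℕ} (h : (Fin (n + 1) → Z) → ℝ) :
    ∑ z, h z = ∑ z₀, ∑ z : Fin n → Z, h (Fin.cons z₀ z) := by
  rw [← Fintype.sum_prod_type']
  exact (Equiv.sum_comp (Fin.consEquiv fun _ => Z) h).symm

/-- The variance of a sum of independent identically distributed centred variables. -/
lemma sum_prod_mul_sq {p ψ : Z → ℝ} (hp : ∑ z, p z = 1) (hψ : ∑ z, p z * ψ z = 0) (n : ℕ) :
    ∑ z : Fin n → Z, (∏ i, p (z i)) * ∑ i, ψ (z i) = 0 ∧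
    ∑ z : Fin n → Z, (∏ i, p (z i)) * (∑ i, ψ (z i)) ^ 2 = n * ∑ z, p z * ψ z ^ 2 := by
  induction n with
  | zero => simp
  | succ n ih =>
    simp only [sum_fin_cons, Fin.prod_univ_succ, Fin.sum_univ_succ, Fin.cons_zero, Fin.cons_succ]
    have h0 := sum_prod_eq_one hp n
    refine ⟨?_, ?_⟩
    · have : ∀ z₀, ∑ z : Fin n → Z, p z₀ * (∏ i, p (z i)) * (ψ z₀ + ∑ i, ψ (z i)) =
          p z₀ * ψ z₀ := by
        intro z₀
        calc _ = p z₀ * ψ z₀ * (∑ z : Fin n → Z, ∏ i, p (z i)) +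
              p z₀ * ∑ z : Fin n → Z, (∏ i, p (z i)) * ∑ i, ψ (z i) := by
              rw [Finset.mul_sum, Finset.mul_sum, ← Finset.sum_add_distrib]
              exact Finset.sum_congr rfl fun z _ => by ring
          _ = _ := by rw [h0, ih.1]; ring
      simp [this, hψ]
    · have : ∀ z₀, ∑ z : Fin n → Z, p z₀ * (∏ i, p (z i)) * (ψ z₀ + ∑ i, ψ (z i)) ^ 2 =
          p z₀ * ψ z₀ ^ 2 + p z₀ * (n * ∑ z, p z * ψ z ^ 2) := by
        intro z₀
        calc _ = p z₀ * ψ z₀ ^ 2 * (∑ z : Fin n → Z, ∏ i, p (z i)) +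
              2 * p z₀ * ψ z₀ * (∑ z : Fin n → Z, (∏ i, p (z i)) * ∑ i, ψ (z i)) +
              p z₀ * ∑ z : Fin n → Z, (∏ i, p (z i)) * (∑ i, ψ (z i)) ^ 2 := by
              rw [Finset.mul_sum, Finset.mul_sum, Finset.mul_sum, ← Finset.sum_add_distrib,
                ← Finset.sum_add_distrib]
              exact Finset.sum_congr rfl fun z _ => by ring
          _ = _ := by rw [h0, ih.1, ih.2]; ring
      rw [Finset.sum_congr rfl fun z₀ _ => this z₀, Finset.sum_add_distrib, ← Finset.sum_mul, hp]
      push_cast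
      ring

/-- The weak law of large numbers for the lower tail, from Chebyshev's inequality. -/
lemma tendsto_lower_tail {p φ : Z → ℝ} (hp : p ∈ stdSimplex ℝ Z) {ρ : ℝ}
    (hρ : ρ < ∑ z, p z * φ z) :
    Tendsto (fun n : ℕ => ∑ z ∈ Finset.univ.filter (fun z : Fin n → Z => ∑ i, φ (z i) ≤ n * ρ),
      ∏ i, p (z i)) atTop (𝓝 0) := by
  set μ := ∑ z, p z * φ z with hμ
  set ψ : Z → ℝ := fun z => φ z - μ with hψ
  have hψ0 : ∑ z, p z * ψ z = 0 := by
    simp only [hψ, mul_sub, Finset.sum_sub_distrib, ← Finset.sum_mul, hp.2]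
    simp [hμ]
  have hprod : ∀ n (z : Fin n → Z), 0 ≤ ∏ i, p (z i) := fun n z =>
    Finset.prod_nonneg fun i _ => hp.1 _
  have hbound : ∀ n : ℕ, 0 < n →
      ∑ z ∈ Finset.univ.filter (fun z : Fin n → Z => ∑ i, φ (z i) ≤ n * ρ), ∏ i, p (z i)
        ≤ (∑ z, p z * ψ z ^ 2) / (μ - ρ) ^ 2 / n := by
    intro n hn
    have hn' : (0 : ℝ) < n := by exact_mod_cast hn
    have hd : 0 < μ - ρ := by linarith
    rw [div_div, le_div_iff₀ (by positivity), Finset.sum_mul]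
    refine le_of_mul_le_mul_left ?_ hn'
    rw [← (sum_prod_mul_sq hp.2 hψ0 n).2, Finset.mul_sum]
    refine (Finset.sum_le_sum fun z hz => ?_).trans
      (Finset.sum_le_sum_of_subset_of_nonneg (Finset.subset_univ _) fun z _ _ =>
        mul_nonneg (hprod n z) (sq_nonneg _))
    simp only [Finset.mem_filter, Finset.mem_univ, true_and] at hz
    have h1 : ∑ i, ψ (z i) = ∑ i, φ (z i) - n * μ := by simp [hψ, Finset.sum_sub_distrib]
    have h2 : (n * (μ - ρ)) ^ 2 ≤ (∑ i, ψ (z i)) ^ 2 := by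
      rw [← neg_sq (∑ i, ψ (z i)), h1]
      exact pow_le_pow_left₀ (by positivity) (by linarith) 2
    calc (n : ℝ) * ((∏ i, p (z i)) * ((μ - ρ) ^ 2 * n))
        = (∏ i, p (z i)) * (n * (μ - ρ)) ^ 2 := by ring
      _ ≤ _ := mul_le_mul_of_nonneg_left h2 (hprod n z)
  refine squeeze_zero' (Eventually.of_forall fun n => Finset.sum_nonneg fun z _ => hprod n z)
    ?_ (tendsto_const_div_atTop_nhds_zero_nat ((∑ z, p z * ψ z ^ 2) / (μ - ρ) ^ 2))
  filter_upwards [eventually_gt_atTop 0] with n hn using hbound n hn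

end WeakLaw

/-! ### Coding for memoryless channels with a cost constraint -/

section CodingTheorem

variable {T V : Type*} [Fintype T]

lemma outputLaw_prod (Q : T → V → ℝ) (p : T → ℝ) {n : ℕ} (v : Fin n → V) :
    outputLaw (fun (x : Fin n → T) v => ∏ i, Q (x i) (v i)) (fun x => ∏ i, p (x i)) v =
      ∏ i, outputLaw Q p (v i) := by
  simp only [outputLaw, ← Finset.prod_mul_distrib]
  exact sum_prod_eq_prod_sum fun i t => p t * Q t (v i)

variable [Fintype V]

lemma prod_mem_stdSimplex {n : ℕ} {r : Fin n → V → ℝ} (hr : ∀ i, r i ∈ stdSimplex ℝ V) :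
    (fun v : Fin n → V => ∏ i, r i (v i)) ∈ stdSimplex ℝ (Fin n → V) := by
  refine ⟨fun v => Finset.prod_nonneg fun i _ => (hr i).1 _, ?_⟩
  rw [sum_prod_eq_prod_sum]
  exact Finset.prod_eq_one fun i _ => (hr i).2

/-- Independent inputs violate the cost constraint with vanishing probability, if the mean cost is
below the bound or if no letter in use exceeds the bound. -/
lemma tendsto_cost_violation {p : T → ℝ} (hp : p ∈ stdSimplex ℝ T) {cost : T → ℝ} {Γ : ℝ}
    (hcost : ∑ t, p t * cost t < Γ ∨ ∀ t, p t ≠ 0 → cost t ≤ Γ) :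
    Tendsto (fun n : ℕ => ∑ x ∈ Finset.univ.filter
      (fun x : Fin n → T => ¬ ∑ i, cost (x i) ≤ n * Γ), ∏ i, p (x i)) atTop (𝓝 0) := by
  have hprod : ∀ n (z : Fin n → T), 0 ≤ ∏ i, p (z i) := fun n z =>
    Finset.prod_nonneg fun i _ => hp.1 _
  rcases hcost with h | h
  · have h' : -Γ < ∑ t, p t * -cost t := by
      simp only [mul_neg, Finset.sum_neg_distrib]
      linarith
    refine squeeze_zero (fun n => Finset.sum_nonneg fun x _ => hprod n x) (fun n => ?_)
      (tendsto_lower_tail hp h')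
    refine Finset.sum_le_sum_of_subset_of_nonneg (fun x hx => ?_) fun x _ _ => hprod n x
    simp only [Finset.mem_filter, Finset.mem_univ, true_and, not_le,
      Finset.sum_neg_distrib] at hx ⊢
    linarith
  · refine tendsto_const_nhds.congr fun n => (Finset.sum_eq_zero fun x hx => ?_).symm
    simp only [Finset.mem_filter, Finset.mem_univ, true_and] at hx
    by_contra h0
    refine hx ?_
    calc ∑ i, cost (x i) ≤ ∑ _i : Fin n, Γ := Finset.sum_le_sum fun i _ =>
          h _ fun hi => h0 (Finset.prod_eq_zero (Finset.mem_univ i) hi)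
      _ = n * Γ := by simp

/-- The probability that the likelihood ratio of a block is at most `2 ^ (n ρ)` is a lower tail
probability of a sum of independent information densities. -/
lemma sum_low_density_le {p : T → ℝ} {Q : T → V → ℝ} (hp : p ∈ stdSimplex ℝ T)
    (hQ : ∀ t, Q t ∈ stdSimplex ℝ V) (n : ℕ) (ρ : ℝ) :
    ∑ x : Fin n → T, (∏ i, p (x i)) * ∑ v ∈ Finset.univ.filter (fun v : Fin n → V =>
        ¬ (2 : ℝ) ^ (n * ρ) * ∏ i, outputLaw Q p (v i) < ∏ i, Q (x i) (v i)), ∏ i, Q (x i) (v i)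
      ≤ ∑ z ∈ Finset.univ.filter (fun z : Fin n → T × V =>
          ∑ i, Real.logb 2 (Q (z i).1 (z i).2 / outputLaw Q p (z i).2) ≤ n * ρ),
        ∏ i, p (z i).1 * Q (z i).1 (z i).2 := by
  classical
  rw [Finset.sum_filter, ← Equiv.sum_comp (Equiv.arrowProdEquivProdArrow (Fin n) (fun _ => T)
    (fun _ => V)).symm, Fintype.sum_prod_type]
  refine Finset.sum_le_sum fun x _ => ?_
  rw [Finset.sum_filter, Finset.mul_sum]
  refine Finset.sum_le_sum fun v _ => ?_
  change _ ≤ if ∑ i, Real.logb 2 (Q (x i) (v i) / outputLaw Q p (v i)) ≤ n * ρ then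
    ∏ i, p (x i) * Q (x i) (v i) else 0
  have hnn : 0 ≤ ∏ i, p (x i) * Q (x i) (v i) :=
    Finset.prod_nonneg fun i _ => mul_nonneg (hp.1 _) ((hQ _).1 _)
  rw [mul_ite, mul_zero, ← Finset.prod_mul_distrib]
  by_cases h0 : ∏ i, p (x i) * Q (x i) (v i) = 0
  · simp [h0]
  have hpos : ∀ i, 0 < p (x i) ∧ 0 < Q (x i) (v i) := by
    intro i
    have hi := Finset.prod_ne_zero_iff.1 h0 i (Finset.mem_univ i)
    exact ⟨(hp.1 _).lt_of_ne' (left_ne_zero_of_mul hi),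
      ((hQ _).1 _).lt_of_ne' (right_ne_zero_of_mul hi)⟩
  have hq : ∀ i, 0 < outputLaw Q p (v i) := fun i =>
    outputLaw_pos (fun t => (hQ t).1) hp.1 (hpos i).1 (hpos i).2
  by_cases h1 : (2 : ℝ) ^ (n * ρ) * ∏ i, outputLaw Q p (v i) < ∏ i, Q (x i) (v i)
  · rw [if_neg (not_not_intro h1)]
    split_ifs
    exacts [hnn, le_rfl]
  · rw [if_pos h1, if_pos]
    rw [not_lt, ← div_le_iff₀ (Finset.prod_pos fun i _ => hq i), ← Finset.prod_div_distrib] at h1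
    rw [← Real.logb_prod _ _ fun i _ => (div_pos (hpos i).2 (hq i)).ne',
      Real.logb_le_iff_le_rpow one_lt_two
        (Finset.prod_pos fun i _ => div_pos (hpos i).2 (hq i))]
    exact h1

/-- The coding theorem for a memoryless channel under a cost constraint on every codeword: all rates
below the mutual information are achieved with a vanishing maximal error. -/
theorem exists_codes {p : T → ℝ} {Q : T → V → ℝ} (hp : p ∈ stdSimplex ℝ T)
    (hQ : ∀ t, Q t ∈ stdSimplex ℝ V) {cost : T → ℝ} {Γ : ℝ}
    (hcost : ∑ t, p t * cost t < Γ ∨ ∀ t, p t ≠ 0 → cost t ≤ Γ) {R : ℝ} (hR0 : 0 ≤ R)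
    (hR : R < channelInfo Q p) :
    ∃ ε : ℕ → ℝ, Tendsto ε atTop (𝓝 0) ∧ ∀ᶠ n : ℕ in atTop,
      ∃ (x : Fin ⌈(2 : ℝ) ^ (n * R)⌉₊ → Fin n → T)
        (dec : (Fin n → V) → Fin ⌈(2 : ℝ) ^ (n * R)⌉₊),
        ∀ m, ∑ i, cost (x m i) ≤ n * Γ ∧
          ∑ v, (if dec v = m then 0 else ∏ i, Q (x m i) (v i)) ≤ ε n := by
  classical
  obtain ⟨ρ, hRρ, hρ⟩ := exists_between hR
  set M : ℕ → ℕ := fun n => ⌈(2 : ℝ) ^ (n * R)⌉₊ with hM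
  set e₁ : ℕ → ℝ := fun n => ∑ z ∈ Finset.univ.filter (fun z : Fin n → T × V =>
    ∑ i, Real.logb 2 (Q (z i).1 (z i).2 / outputLaw Q p (z i).2) ≤ n * ρ),
      ∏ i, p (z i).1 * Q (z i).1 (z i).2 with he₁
  set e₂ : ℕ → ℝ := fun n => ∑ x ∈ Finset.univ.filter
    (fun x : Fin n → T => ¬ ∑ i, cost (x i) ≤ n * Γ), ∏ i, p (x i) with he₂
  have hlim₁ : Tendsto e₁ atTop (𝓝 0) := by
    refine tendsto_lower_tail (Z := T × V) (p := fun z => p z.1 * Q z.1 z.2)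
      (φ := fun z => Real.logb 2 (Q z.1 z.2 / outputLaw Q p z.2))
      ⟨fun z => mul_nonneg (hp.1 _) ((hQ _).1 _), ?_⟩ ?_
    · rw [Fintype.sum_prod_type]
      simp [← Finset.mul_sum, (hQ _).2, hp.2]
    · rw [Fintype.sum_prod_type]
      simpa only [channelInfo, divergence, Finset.mul_sum, mul_assoc] using hρ
  have hlim₂ : Tendsto e₂ atTop (𝓝 0) := tendsto_cost_violation hp hcost
  have hlim₃ : Tendsto (fun n => (M n : ℝ) / 2 ^ (n * ρ)) atTop (𝓝 0) := by
    have hgeo : Tendsto (fun n : ℕ => 2 * ((2 : ℝ) ^ (R - ρ)) ^ n) atTop (𝓝 0) := by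
      simpa using (tendsto_pow_atTop_nhds_zero_of_lt_one (r := (2 : ℝ) ^ (R - ρ)) (by positivity)
        (Real.rpow_lt_one_of_one_lt_of_neg one_lt_two (by linarith))).const_mul 2
    refine squeeze_zero (fun n => by positivity) (fun n => ?_) hgeo
    have h1 : (1 : ℝ) ≤ 2 ^ (n * R) := Real.one_le_rpow one_le_two (by positivity)
    have h2 : (M n : ℝ) < 2 ^ (n * R) + 1 := Nat.ceil_lt_add_one (by positivity)
    rw [← Real.rpow_natCast, ← Real.rpow_mul zero_le_two, div_le_iff₀ (by positivity), mul_assoc,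
      ← Real.rpow_add zero_lt_two]
    ring_nf at h1 h2 ⊢
    linarith
  -- the last term makes the inequality required by the maximal code lemma strict
  refine ⟨fun n => e₁ n + e₂ n + M n / 2 ^ (n * ρ) + 1 / ((n : ℝ) + 1), ?_, ?_⟩
  · simpa using ((hlim₁.add hlim₂).add hlim₃).add tendsto_one_div_add_atTop_nhds_zero_nat
  have hlim := ((hlim₁.add hlim₂).add hlim₃).add
    (tendsto_one_div_add_atTop_nhds_zero_nat (𝕜 := ℝ))
  simp only [add_zero] at hlim
  filter_upwards [hlim.eventually_le_const zero_lt_one] with n hn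
  set P : (Fin n → T) → ℝ := fun x => ∏ i, p (x i) with hP
  set K : (Fin n → T) → (Fin n → V) → ℝ := fun x v => ∏ i, Q (x i) (v i) with hK
  set F : Finset (Fin n → T) := Finset.univ.filter fun x => ∑ i, cost (x i) ≤ n * Γ with hF
  have hPs : P ∈ stdSimplex ℝ (Fin n → T) := prod_mem_stdSimplex fun _ => hp
  have hKs : ∀ x, K x ∈ stdSimplex ℝ (Fin n → V) := fun x => prod_mem_stdSimplex fun i => hQ (x i)
  have htail := sum_low_density_le hp hQ n ρ
  -- with the complementary probability `e₁ + e₂`, a word meets the cost and has a high density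
  have hmain : 1 - (e₁ n + e₂ n) ≤ ∑ x ∈ F, P x * ∑ v ∈ Finset.univ.filter
      (fun v => (2 : ℝ) ^ (n * ρ) * outputLaw K P v < K x v), K x v := by
    have hsplit : ∀ x, P x = P x * ∑ v ∈ Finset.univ.filter
        (fun v => (2 : ℝ) ^ (n * ρ) * outputLaw K P v < K x v), K x v
        + P x * ∑ v ∈ Finset.univ.filter
        (fun v => ¬ (2 : ℝ) ^ (n * ρ) * outputLaw K P v < K x v), K x v := by
      intro x
      rw [← mul_add, Finset.sum_filter_add_sum_filter_not, (hKs x).2, mul_one]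
    have hone : ∑ x ∈ F, P x + e₂ n = 1 := by
      rw [← hPs.2]
      exact Finset.sum_filter_add_sum_filter_not _ _ _
    have hlow : ∑ x ∈ F, P x * ∑ v ∈ Finset.univ.filter
        (fun v => ¬ (2 : ℝ) ^ (n * ρ) * outputLaw K P v < K x v), K x v ≤ e₁ n := by
      refine le_trans (Finset.sum_le_sum_of_subset_of_nonneg (Finset.subset_univ _)
        fun x _ _ => mul_nonneg (hPs.1 x) (Finset.sum_nonneg fun v _ => (hKs x).1 v)) ?_
      simp only [hK, hP, outputLaw_prod]
      exact htail
    have := Finset.sum_congr (rfl : F = F) fun x _ => hsplit x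
    rw [Finset.sum_add_distrib] at this
    linarith
  have hpos : (0 : ℝ) < 1 / ((n : ℝ) + 1) := by positivity
  obtain ⟨x, D, hxF, hD, herr⟩ := exists_maximal_code hPs hKs F
    (Real.rpow_pos_of_pos two_pos (n * ρ)) hn (M n) (by linarith)
  have hM0 : 0 < M n := Nat.ceil_pos.2 (by positivity)
  obtain ⟨dec, hdec⟩ : ∃ dec : (Fin n → V) → Fin (M n), ∀ m, ∀ v ∈ D m, dec v = m := by
    refine ⟨fun v => if h : ∃ m, v ∈ D m then h.choose else ⟨0, hM0⟩, fun m v hv => ?_⟩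
    have h : ∃ m, v ∈ D m := ⟨m, hv⟩
    simp only [dif_pos h]
    by_contra hne
    exact Finset.disjoint_left.1 (hD _ _ hne) h.choose_spec hv
  refine ⟨x, dec, fun m => ⟨by simpa [hF] using hxF m, ?_⟩⟩
  have h1 := Finset.sum_add_sum_compl (D m) (K (x m))
  rw [(hKs _).2] at h1
  calc ∑ v, (if dec v = m then 0 else K (x m) v) ≤ ∑ v ∈ (D m)ᶜ, K (x m) v := by
        rw [← Finset.sum_add_sum_compl (D m), Finset.sum_eq_zero fun v hv => if_pos (hdec m v hv),
          zero_add]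
        refine Finset.sum_le_sum fun v _ => ?_
        split_ifs
        exacts [(hKs _).1 v, le_rfl]
    _ ≤ _ := by linarith [herr m]

end CodingTheorem

/-! ### Path laws under causal selection -/

section CausalPaths

variable {Ω T V : Type*}

/-- The `i`-th letter `τ ω i` depends on the entries of `ω` before `i` only. -/
def IsCausal {n : ℕ} (τ : (Fin n → Ω) → Fin n → T) : Prop :=
  ∀ i ω ω', (∀ j < i, ω j = ω' j) → τ ω i = τ ω' i

/-- The probability of the path `ω` when each entry is drawn from the kernel `k`, given the letter
that `τ` selects from the past. -/
def pathLaw {n : ℕ} (k : T → Ω → ℝ) (τ : (Fin n → Ω) → Fin n → T) (ω : Fin n → Ω) : ℝ :=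
  ∏ i, k (τ ω i) (ω i)

lemma IsCausal.cons {n : ℕ} {τ : (Fin (n + 1) → Ω) → Fin (n + 1) → T} (h : IsCausal τ) (x : Ω) :
    IsCausal fun (ω : Fin n → Ω) i => τ (Fin.cons x ω) i.succ := by
  refine fun i ω ω' hω => h _ _ _ fun j hj => ?_
  cases j using Fin.cases with
  | zero => rfl
  | succ j => exact hω j (by simpa using hj)

lemma IsCausal.exists_head {n : ℕ} {τ : (Fin (n + 1) → Ω) → Fin (n + 1) → T} (h : IsCausal τ)
    [Nonempty Ω] : ∃ t, ∀ ω, τ ω 0 = t :=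
  ⟨τ (fun _ => Classical.arbitrary Ω) 0,
    fun _ => h _ _ _ fun j hj => absurd hj (Fin.not_lt_zero j)⟩

lemma pathLaw_nonneg {n : ℕ} {k : T → Ω → ℝ} (hk : ∀ t x, 0 ≤ k t x) (τ : (Fin n → Ω) → Fin n → T)
    (ω : Fin n → Ω) : 0 ≤ pathLaw k τ ω :=
  Finset.prod_nonneg fun _ _ => hk _ _

lemma pathLaw_cons {n : ℕ} (k : T → Ω → ℝ) {τ : (Fin (n + 1) → Ω) → Fin (n + 1) → T} {t : T}
    (ht : ∀ ω, τ ω 0 = t) (x : Ω) (ω : Fin n → Ω) :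
    pathLaw k τ (Fin.cons x ω) =
      k t x * pathLaw k (fun ω i => τ (Fin.cons x ω) i.succ) ω := by
  simp [pathLaw, Fin.prod_univ_succ, ht]

variable [Fintype Ω] [Nonempty Ω]

lemma sum_pathLaw {k : T → Ω → ℝ} (hk : ∀ t, ∑ x, k t x = 1) {n : ℕ}
    {τ : (Fin n → Ω) → Fin n → T} (hτ : IsCausal τ) : ∑ ω, pathLaw k τ ω = 1 := by
  induction n with
  | zero => simp [pathLaw]
  | succ n ih =>
    obtain ⟨t, ht⟩ := hτ.exists_head
    simp [sum_fin_cons, pathLaw_cons k ht, ← Finset.mul_sum, ih (hτ.cons _), hk]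

/-- Given the letter selected at time `i`, the entry at time `i` has law `k`, whatever the past. -/
lemma sum_pathLaw_mul {k : T → Ω → ℝ} (hk : ∀ t, ∑ x, k t x = 1) (φ : T → Ω → ℝ) {n : ℕ}
    {τ : (Fin n → Ω) → Fin n → T} (hτ : IsCausal τ) (i : Fin n) :
    ∑ ω, pathLaw k τ ω * φ (τ ω i) (ω i) =
      ∑ ω, pathLaw k τ ω * ∑ x, k (τ ω i) x * φ (τ ω i) x := by
  induction n with
  | zero => exact i.elim0
  | succ n ih =>
    obtain ⟨t, ht⟩ := hτ.exists_head
    simp only [sum_fin_cons, pathLaw_cons k ht]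
    cases i using Fin.cases with
    | zero =>
      simp only [ht, Fin.cons_zero, ← Finset.sum_mul, ← Finset.mul_sum, sum_pathLaw hk (hτ.cons _),
        mul_one, hk, one_mul]
    | succ i =>
      simp only [Fin.cons_succ, mul_assoc, ← Finset.mul_sum]
      exact Finset.sum_congr rfl fun x _ => congrArg _ (ih (hτ.cons x) i)

/-- If under each letter the weights `r` project to weights below `b`, then a causal choice of the
letters cannot push the projected path weights above the product of `b`. -/
lemma sum_pathLaw_le [Fintype V] [DecidableEq V] {r : T → Ω → ℝ} {b : V → ℝ} (ν : Ω → V)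
    (hr : ∀ t x, 0 ≤ r t x) (hb : ∀ t v, pushLaw ν (r t) v ≤ b v) {n : ℕ}
    {τ : (Fin n → Ω) → Fin n → T} (hτ : IsCausal τ) (h : (Fin n → V) → ℝ) (hh : ∀ v, 0 ≤ h v) :
    ∑ ω, pathLaw r τ ω * h (fun i => ν (ω i)) ≤ ∑ v, (∏ i, b (v i)) * h v := by
  induction n with
  | zero =>
    simp only [pathLaw, Finset.univ_eq_empty, Finset.prod_empty, one_mul, Fintype.sum_unique]
    exact (congrArg h (Subsingleton.elim _ _)).le
  | succ n ih =>
    obtain ⟨t, ht⟩ := hτ.exists_head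
    have hb0 : ∀ v, 0 ≤ b v := fun v => le_trans
      (Finset.sum_nonneg fun x _ => by split_ifs; exacts [hr t x, le_rfl]) (hb t v)
    set H : V → ℝ := fun v₀ => ∑ v : Fin n → V, (∏ i, b (v i)) * h (Fin.cons v₀ v) with hH
    have hH0 : ∀ v₀, 0 ≤ H v₀ := fun v₀ => Finset.sum_nonneg fun v _ =>
      mul_nonneg (Finset.prod_nonneg fun i _ => hb0 _) (hh _)
    calc ∑ ω, pathLaw r τ ω * h (fun i => ν (ω i))
        = ∑ x, r t x * ∑ ω : Fin n → Ω, pathLaw r (fun ω i => τ (Fin.cons x ω) i.succ) ω *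
            h (Fin.cons (ν x) fun i => ν (ω i)) := by
          simp only [sum_fin_cons, pathLaw_cons r ht, mul_assoc, ← Finset.mul_sum]
          refine Finset.sum_congr rfl fun x _ => congrArg _ (Finset.sum_congr rfl fun ω _ => ?_)
          congr 2
          funext i
          cases i using Fin.cases <;> simp
      _ ≤ ∑ x, r t x * H (ν x) := Finset.sum_le_sum fun x _ =>
          mul_le_mul_of_nonneg_left (ih (hτ.cons x) _ fun v => hh _) (hr t x)
      _ = ∑ v, pushLaw ν (r t) v * H v := (sum_pushLaw_mul ν (r t) H).symm
      _ ≤ ∑ v, b v * H v := Finset.sum_le_sum fun v _ =>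
          mul_le_mul_of_nonneg_right (hb t v) (hH0 v)
      _ = _ := by
          simp only [sum_fin_cons, Fin.prod_univ_succ, Fin.cons_zero, Fin.cons_succ, mul_assoc,
            ← Finset.mul_sum, hH]

end CausalPaths

/-! ### The converse for causally selected letters -/

section Converse

variable {Ω T V : Type*} [Fintype Ω] [DecidableEq T] {n M : ℕ}

/-- The law of the letter selected at a uniformly chosen time, for a uniform message `m` and the
causal selection `τ m`. -/
noncomputable def averageLaw (k : T → Ω → ℝ) (τ : Fin M → (Fin n → Ω) → Fin n → T) (t : T) : ℝ :=
  1 / (n * M : ℝ) * ∑ m, ∑ ω, pathLaw k (τ m) ω * ∑ i, if τ m ω i = t then 1 else 0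

lemma averageLaw_nonneg {k : T → Ω → ℝ} (hk : ∀ t x, 0 ≤ k t x)
    (τ : Fin M → (Fin n → Ω) → Fin n → T) (t : T) : 0 ≤ averageLaw k τ t :=
  mul_nonneg (by positivity) (Finset.sum_nonneg fun m _ => Finset.sum_nonneg fun ω _ =>
    mul_nonneg (pathLaw_nonneg hk _ _) (Finset.sum_nonneg fun i _ => by positivity))

lemma averageLaw_pos {k : T → Ω → ℝ} (hk : ∀ t x, 0 ≤ k t x) (hn : 0 < n) (hM : 0 < M)
    {τ : Fin M → (Fin n → Ω) → Fin n → T} {m : Fin M} {ω : Fin n → Ω}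
    (hω : 0 < pathLaw k (τ m) ω) (i : Fin n) : 0 < averageLaw k τ (τ m ω i) := by
  have hn' : (0 : ℝ) < n := by exact_mod_cast hn
  have hM' : (0 : ℝ) < M := by exact_mod_cast hM
  have h1 : ∀ m' ω', 0 ≤ pathLaw k (τ m') ω' *
      ∑ j, if τ m' ω' j = τ m ω i then (1 : ℝ) else 0 := fun m' ω' =>
    mul_nonneg (pathLaw_nonneg hk _ _) (Finset.sum_nonneg fun i _ => by positivity)
  refine mul_pos (by positivity) ?_
  refine Finset.sum_pos' (fun m' _ => Finset.sum_nonneg fun ω' _ => h1 m' ω')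
    ⟨m, Finset.mem_univ m, Finset.sum_pos' (fun ω' _ => h1 m ω') ⟨ω, Finset.mem_univ ω, ?_⟩⟩
  exact mul_pos hω (Finset.sum_pos' (fun j _ => by positivity) ⟨i, Finset.mem_univ i, by simp⟩)

variable [Fintype T]

lemma sum_averageLaw_mul (k : T → Ω → ℝ) (τ : Fin M → (Fin n → Ω) → Fin n → T) (w : T → ℝ) :
    ∑ t, averageLaw k τ t * w t =
      1 / (n * M : ℝ) * ∑ m, ∑ ω, pathLaw k (τ m) ω * ∑ i, w (τ m ω i) := by
  simp only [averageLaw, mul_assoc, ← Finset.mul_sum, Finset.sum_mul]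
  congr 1
  rw [Finset.sum_comm]
  refine Finset.sum_congr rfl fun m _ => ?_
  rw [Finset.sum_comm]
  refine Finset.sum_congr rfl fun ω _ => ?_
  rw [← Finset.mul_sum, Finset.sum_comm]
  simp

lemma sum_averageLaw_mul_le [Nonempty Ω] {k : T → Ω → ℝ} (hk : ∀ t, k t ∈ stdSimplex ℝ Ω)
    (hn : 0 < n) (hM : 0 < M) {τ : Fin M → (Fin n → Ω) → Fin n → T} (hτ : ∀ m, IsCausal (τ m))
    {w : T → ℝ} {c : ℝ} (hw : ∀ m ω, ∑ i, w (τ m ω i) ≤ n * c) :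
    ∑ t, averageLaw k τ t * w t ≤ c := by
  have hn' : (0 : ℝ) < n := by exact_mod_cast hn
  have hM' : (0 : ℝ) < M := by exact_mod_cast hM
  rw [sum_averageLaw_mul]
  calc 1 / (n * M : ℝ) * ∑ m, ∑ ω, pathLaw k (τ m) ω * ∑ i, w (τ m ω i)
      ≤ 1 / (n * M : ℝ) * ∑ m, ∑ ω, pathLaw k (τ m) ω * (n * c) := by
        refine mul_le_mul_of_nonneg_left (Finset.sum_le_sum fun m _ => Finset.sum_le_sum fun ω _ =>
          mul_le_mul_of_nonneg_left (hw m ω) (pathLaw_nonneg (fun t => (hk t).1) _ _))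
          (by positivity)
    _ = c := by
        simp only [← Finset.sum_mul, sum_pathLaw (fun t => (hk t).2) (hτ _)]
        simp
        field_simp

lemma averageLaw_mem_stdSimplex [Nonempty Ω] {k : T → Ω → ℝ} (hk : ∀ t, k t ∈ stdSimplex ℝ Ω)
    (hn : 0 < n) (hM : 0 < M) {τ : Fin M → (Fin n → Ω) → Fin n → T} (hτ : ∀ m, IsCausal (τ m)) :
    averageLaw k τ ∈ stdSimplex ℝ T := by
  refine ⟨averageLaw_nonneg (fun t => (hk t).1) τ, le_antisymm ?_ ?_⟩
  · simpa using sum_averageLaw_mul_le hk hn hM hτ (w := fun _ => 1) (c := 1) (by simp)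
  · simpa using sum_averageLaw_mul_le hk hn hM hτ (w := fun _ => -1) (c := -1) (by simp)

variable [Fintype V] [DecidableEq V]

/-- The converse. Only the projection `ν` of the paths is seen by the decoder, and `Q` is the
channel from letters to such projections. The likelihood ratio of a path against independent outputs
with the average output law has mean logarithm `n` times the information of the average law, and
Gibbs' inequality compares it with the ratio `M / 2` on correct decoding and `1 / 2` elsewhere. -/
theorem correct_mul_log_le [Nonempty Ω] {k : T → Ω → ℝ} (hk : ∀ t, k t ∈ stdSimplex ℝ Ω)
    (ν : Ω → V) (hn : 0 < n) (hM : 0 < M) {τ : Fin M → (Fin n → Ω) → Fin n → T}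
    (hτ : ∀ m, IsCausal (τ m)) (dec : (Fin n → V) → Fin M) :
    (1 / (M : ℝ) * ∑ m, ∑ ω, if dec (fun i => ν (ω i)) = m then pathLaw k (τ m) ω else 0) *
      Real.logb 2 M ≤ n * channelInfo (fun t => pushLaw ν (k t)) (averageLaw k τ) + 1 := by
  have hn' : (0 : ℝ) < n := by exact_mod_cast hn
  have hM' : (0 : ℝ) < M := by exact_mod_cast hM
  have hM1 : (1 : ℝ) ≤ M := by exact_mod_cast hM
  have hk0 : ∀ t x, 0 ≤ k t x := fun t => (hk t).1
  set Q : T → V → ℝ := fun t => pushLaw ν (k t) with hQ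
  have hQs : ∀ t, Q t ∈ stdSimplex ℝ V := fun t => pushLaw_mem_stdSimplex ν (hk t)
  have hQ0 : ∀ t v, 0 ≤ Q t v := fun t => (hQs t).1
  set p := averageLaw k τ with hp
  have hps : p ∈ stdSimplex ℝ T := averageLaw_mem_stdSimplex hk hn hM hτ
  set q := outputLaw Q p with hq
  have hq0 : ∀ v, 0 ≤ q v := outputLaw_nonneg hQ0 hps.1
  have hq1 : ∑ v, q v = 1 := (sum_outputLaw fun t => (hQs t).2).trans hps.2
  set r : T → Ω → ℝ := fun t x => k t x * (q (ν x) / Q t (ν x)) with hr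
  have hr0 : ∀ t x, 0 ≤ r t x := fun t x => mul_nonneg (hk0 t x) (div_nonneg (hq0 _) (hQ0 _ _))
  have hrq : ∀ t v, pushLaw ν (r t) v ≤ q v := by
    intro t v
    have : pushLaw ν (r t) v = Q t v * (q v / Q t v) := by
      simp only [hQ, pushLaw, Finset.sum_mul]
      refine Finset.sum_congr rfl fun x _ => ?_
      split_ifs with h
      · simp only [hr, h, hQ, pushLaw]
      · simp
    rw [this]
    rcases (hQ0 t v).eq_or_lt with h | h
    · simpa [← h] using hq0 v
    · rw [mul_div_cancel₀ _ h.ne']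
  set φ : Fin M → (Fin n → V) → ℝ := fun m v => ((if dec v = m then (M : ℝ) else 0) + 1) / 2 with hφ
  have hφ0 : ∀ m v, 0 < φ m v := by
    intro m v
    simp only [hφ]
    positivity
  have hφlog : ∀ m v, (if dec v = m then Real.log M else 0) - Real.log 2 ≤ Real.log (φ m v) := by
    intro m v
    simp only [hφ]
    split_ifs
    · rw [← Real.log_div hM'.ne' two_ne_zero]
      exact Real.log_le_log (by positivity) (by linarith)
    · rw [Real.log_div (by norm_num) two_ne_zero]
      simp
  -- the change of measure: the tilted path weights `r` see the decoder only through `q`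
  have htilt : ∑ m, ∑ ω, pathLaw r (τ m) ω * φ m (fun i => ν (ω i)) ≤ M := by
    calc _ ≤ ∑ m, ∑ v : Fin n → V, (∏ i, q (v i)) * φ m v := Finset.sum_le_sum fun m _ =>
          sum_pathLaw_le ν hr0 hrq (hτ m) (φ m) fun v => (hφ0 m v).le
      _ = ∑ v : Fin n → V, (∏ i, q (v i)) * M := by
          rw [Finset.sum_comm]
          refine Finset.sum_congr rfl fun v _ => ?_
          rw [← Finset.mul_sum]
          congr 1
          simp only [hφ, ← Finset.sum_div, Finset.sum_add_distrib]
          simp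
      _ = M := by rw [← Finset.sum_mul, sum_prod_eq_one hq1, one_mul]
  -- the mean of the logarithm of the likelihood ratio
  have hmean : (n * M : ℝ) * channelInfo Q p = ∑ m, ∑ ω, pathLaw k (τ m) ω *
      ∑ i, Real.logb 2 (Q (τ m ω i) (ν (ω i)) / q (ν (ω i))) := by
    rw [channelInfo, hp, sum_averageLaw_mul, ← mul_assoc, mul_one_div_cancel (by positivity),
      one_mul]
    refine Finset.sum_congr rfl fun m _ => ?_
    simp only [Finset.mul_sum]
    rw [Finset.sum_comm, Finset.sum_comm (s := Finset.univ (α := Fin n → Ω))]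
    refine Finset.sum_congr rfl fun i _ => ?_
    rw [sum_pathLaw_mul (fun t => (hk t).2) (fun t x => Real.logb 2 (Q t (ν x) / q (ν x))) (hτ m) i]
    refine Finset.sum_congr rfl fun ω _ => ?_
    congr 1
    rw [divergence]
    exact sum_pushLaw_mul ν (k (τ m ω i)) fun v => Real.logb 2 (Q (τ m ω i) v / q v)
  have hpoint : ∀ m ω, pathLaw k (τ m) ω *
        ((if dec (fun i => ν (ω i)) = m then Real.log M else 0) - Real.log 2 + 1)
        - pathLaw r (τ m) ω * φ m (fun i => ν (ω i)) ≤
      pathLaw k (τ m) ω * (∑ i, Real.logb 2 (Q (τ m ω i) (ν (ω i)) / q (ν (ω i)))) *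
        Real.log 2 := by
    intro m ω
    rcases (pathLaw_nonneg hk0 (τ m) ω).eq_or_lt with h0 | h0
    · rw [← h0]
      simpa using mul_nonneg (pathLaw_nonneg hr0 (τ m) ω) (hφ0 m _).le
    have hkpos : ∀ i, 0 < k (τ m ω i) (ω i) := fun i =>
      (hk0 _ _).lt_of_ne' (Finset.prod_ne_zero_iff.1 h0.ne' i (Finset.mem_univ i))
    have hQpos : ∀ i, 0 < Q (τ m ω i) (ν (ω i)) := fun i =>
      (hkpos i).trans_le (by
        simp only [hQ, pushLaw]
        refine le_trans (by simp) (Finset.single_le_sum (f := fun x =>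
          if ν x = ν (ω i) then k (τ m ω i) x else 0) (fun x _ => ?_) (Finset.mem_univ (ω i)))
        split_ifs
        exacts [hk0 _ _, le_rfl])
    have hqpos : ∀ i, 0 < q (ν (ω i)) := fun i =>
      outputLaw_pos hQ0 hps.1 (averageLaw_pos hk0 hn hM h0 i) (hQpos i)
    set L := ∏ i, Q (τ m ω i) (ν (ω i)) / q (ν (ω i)) with hL
    have hL0 : 0 < L := Finset.prod_pos fun i _ => div_pos (hQpos i) (hqpos i)
    have hrL : pathLaw r (τ m) ω = pathLaw k (τ m) ω / L := by
      rw [eq_div_iff hL0.ne', pathLaw, pathLaw, hL, ← Finset.prod_mul_distrib]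
      refine Finset.prod_congr rfl fun i _ => ?_
      have h1 := (hQpos i).ne'
      have h2 := (hqpos i).ne'
      simp only [hr]
      field_simp
    have hlogL : (∑ i, Real.logb 2 (Q (τ m ω i) (ν (ω i)) / q (ν (ω i)))) * Real.log 2 =
        Real.log L := by
      rw [← Real.logb_prod _ _ fun i _ => (div_pos (hQpos i) (hqpos i)).ne', Real.logb,
        div_mul_cancel₀ _ (Real.log_pos one_lt_two).ne']
    have hgibbs := Real.log_le_sub_one_of_pos (div_pos (hφ0 m fun i => ν (ω i)) hL0)
    rw [Real.log_div (hφ0 _ _).ne' hL0.ne'] at hgibbs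
    have := hφlog m fun i => ν (ω i)
    rw [mul_assoc, hlogL, hrL, div_mul_eq_mul_div, mul_div_assoc, ← mul_sub]
    exact mul_le_mul_of_nonneg_left (by linarith) h0.le
  have hsum := Finset.sum_le_sum fun m (_ : m ∈ Finset.univ) =>
    Finset.sum_le_sum fun ω (_ : ω ∈ Finset.univ) => hpoint m ω
  simp only [← Finset.sum_mul] at hsum
  rw [← hmean] at hsum
  simp only [Finset.sum_sub_distrib, mul_add, mul_sub, Finset.sum_add_distrib, mul_one, mul_ite,
    mul_zero, ← Finset.sum_mul, sum_pathLaw (fun t => (hk t).2) (hτ _)] at hsum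
  have hlog2 : 0 < Real.log 2 := Real.log_pos one_lt_two
  have hpull : ∑ m, ∑ ω, (if dec (fun i => ν (ω i)) = m then pathLaw k (τ m) ω * Real.log M else 0)
      = (∑ m, ∑ ω, if dec (fun i => ν (ω i)) = m then pathLaw k (τ m) ω else 0) * Real.log M := by
    simp only [Finset.sum_mul, ite_mul, zero_mul]
  rw [hpull] at hsum
  simp only [Finset.sum_const, Finset.card_univ, Fintype.card_fin, nsmul_eq_mul, mul_one] at hsum
  rw [Real.logb, one_div, inv_mul_eq_div, div_mul_div_comm, div_le_iff₀ (by positivity)]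
  linarith

end Converse

/-! ### Shannon strategies -/

section Strategies

variable {A S Se Sd X Y : Type*}

/-- The part `(Y, S_d)` of `(S, S_e, S_d, Y)` that the decoder sees. -/
def decoderView (z : S × Se × Sd × Y) : Y × Sd := (z.2.2.2, z.2.2.1)

/-- The Shannon strategy that a causal code uses at time `i`: the past observations are frozen and
the input is a function of the present one. -/
def Code.strategy {n M : ℕ} (c : Code A Se Sd X Y n M) (m : Fin M)
    (ω : Fin n → S × Se × Sd × Y) (i : Fin n) : A × (Se → X) :=
  (c.action m i, fun x => c.encode m i fun j => if (j : Fin n) = i then x else (ω j).2.1)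

lemma Code.isCausal_strategy {n M : ℕ} (c : Code A Se Sd X Y n M) (m : Fin M) :
    IsCausal (c.strategy (S := S) m) := by
  intro i ω ω' h
  simp only [strategy, Prod.mk.injEq, true_and]
  funext x
  congr 1
  funext j
  split_ifs with hj
  · rfl
  · rw [h j (lt_of_le_of_ne j.2 hj)]

/-- The code that applies a fixed sequence of Shannon strategies for each message. -/
def strategyCode {n M : ℕ} (x : Fin M → Fin n → A × (Se → X)) (dec : (Fin n → Y × Sd) → Fin M) :
    Code A Se Sd X Y n M where
  action m i := (x m i).1
  encode m i se := (x m i).2 (se ⟨i, Set.mem_Iic.2 le_rfl⟩)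
  decode y sd := dec fun i => (y i, sd i)

variable [Fintype S] [Fintype Se] [Fintype Sd] [Fintype Y]

/-- The joint law of `(S, S_e, S_d, Y)` in one channel use with the Shannon strategy `t`: the action
`t.1`, and the channel input `t.2 s_e` after the observation `s_e`. -/
def Model.strategyKernel (W : Model A S Se Sd X Y) (t : A × (Se → X)) (z : S × Se × Sd × Y) : ℝ :=
  W.state z.1 * W.encObs z.1 t.1 z.2.1 * W.decObs z.1 z.2.1 t.1 z.2.2.1 *
    W.channel (t.2 z.2.1) z.1 z.2.2.2

/-- The memoryless channel from Shannon strategies to the pair `(Y, S_d)` seen by the decoder. -/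
def Model.strategyChannel (W : Model A S Se Sd X Y) (t : A × (Se → X)) (v : Y × Sd) : ℝ :=
  ∑ s, ∑ se, W.strategyKernel t (s, se, v.2, v.1)

lemma Model.strategyKernel_mem (W : Model A S Se Sd X Y) (t : A × (Se → X)) :
    W.strategyKernel t ∈ stdSimplex ℝ (S × Se × Sd × Y) := by
  refine ⟨fun z => mul_nonneg (mul_nonneg (mul_nonneg (W.state_mem.1 _) ((W.encObs_mem _ _).1 _))
    ((W.decObs_mem _ _ _).1 _)) ((W.channel_mem _ _).1 _), ?_⟩
  simp only [strategyKernel, Fintype.sum_prod_type, ← Finset.mul_sum, (W.channel_mem _ _).2,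
    mul_one, (W.decObs_mem _ _ _).2, (W.encObs_mem _ _).2, W.state_mem.2]

lemma Model.pushLaw_strategyKernel [DecidableEq (Y × Sd)] (W : Model A S Se Sd X Y)
    (t : A × (Se → X)) :
    pushLaw decoderView (W.strategyKernel t) = W.strategyChannel t := by
  funext ⟨y, sd⟩
  simp only [pushLaw, strategyChannel, Fintype.sum_prod_type, decoderView]
  refine Finset.sum_congr rfl fun s _ => Finset.sum_congr rfl fun se _ => ?_
  rw [Finset.sum_eq_single sd, Finset.sum_eq_single y]
  · simp
  · intro y' _ h
    simp [h]
  · simp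
  · intro sd' _ h
    simp [h]
  · simp

lemma Model.strategyChannel_mem (W : Model A S Se Sd X Y) (t : A × (Se → X)) :
    W.strategyChannel t ∈ stdSimplex ℝ (Y × Sd) := by
  classical
  rw [← W.pushLaw_strategyKernel]
  exact pushLaw_mem_stdSimplex _ (W.strategyKernel_mem t)

lemma Model.codeLaw_eq (W : Model A S Se Sd X Y) {n M : ℕ} (c : Code A Se Sd X Y n M) (m : Fin M)
    (ω : Fin n → S × Se × Sd × Y) :
    W.codeLaw c m (fun i => (ω i).1) (fun i => (ω i).2.1) (fun i => (ω i).2.2.1)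
      (fun i => (ω i).2.2.2) = 1 / (M : ℝ) * pathLaw W.strategyKernel (c.strategy m) ω := by
  simp only [codeLaw, pathLaw, strategyKernel, Code.strategy]
  congr 1
  refine Finset.prod_congr rfl fun i _ => ?_
  congr 3
  funext j
  split_ifs with h
  · rw [h]
  · rfl

lemma sum_prod_arrow {n : ℕ} (h : (Fin n → S) → (Fin n → Se) → (Fin n → Sd) → (Fin n → Y) → ℝ) :
    ∑ s, ∑ se, ∑ sd, ∑ y, h s se sd y = ∑ ω : Fin n → S × Se × Sd × Y, h (fun i => (ω i).1)
      (fun i => (ω i).2.1) (fun i => (ω i).2.2.1) (fun i => (ω i).2.2.2) := by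
  symm
  rw [← Equiv.sum_comp (Equiv.arrowProdEquivProdArrow (Fin n) (fun _ => S)
    (fun _ => Se × Sd × Y)).symm, Fintype.sum_prod_type]
  refine Finset.sum_congr rfl fun s _ => ?_
  rw [← Equiv.sum_comp (Equiv.arrowProdEquivProdArrow (Fin n) (fun _ => Se)
    (fun _ => Sd × Y)).symm, Fintype.sum_prod_type]
  refine Finset.sum_congr rfl fun se _ => ?_
  rw [← Equiv.sum_comp (Equiv.arrowProdEquivProdArrow (Fin n) (fun _ => Sd)
    (fun _ => Y)).symm, Fintype.sum_prod_type]
  rfl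

lemma Model.errorProb_eq (W : Model A S Se Sd X Y) {n M : ℕ} (c : Code A Se Sd X Y n M) :
    W.errorProb c = 1 / (M : ℝ) * ∑ m, ∑ ω : Fin n → S × Se × Sd × Y,
      if c.decode (fun i => (decoderView (ω i)).1) (fun i => (decoderView (ω i)).2) = m then 0
      else pathLaw W.strategyKernel (c.strategy m) ω := by
  rw [errorProb, Finset.mul_sum]
  refine Finset.sum_congr rfl fun m _ => ?_
  rw [sum_prod_arrow, Finset.mul_sum]
  refine Finset.sum_congr rfl fun ω _ => ?_
  rw [codeLaw_eq, mul_ite, mul_zero]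
  rfl

lemma Model.errorProb_nonneg (W : Model A S Se Sd X Y) {n M : ℕ} (c : Code A Se Sd X Y n M) :
    0 ≤ W.errorProb c := by
  rw [errorProb_eq]
  refine mul_nonneg (by positivity) (Finset.sum_nonneg fun m _ => Finset.sum_nonneg fun ω _ => ?_)
  split_ifs
  exacts [le_rfl, pathLaw_nonneg (fun t => (W.strategyKernel_mem t).1) _ _]

lemma Model.nonempty_path (W : Model A S Se Sd X Y) [Nonempty A] [Nonempty X] :
    Nonempty (S × Se × Sd × Y) := by
  by_contra h
  rw [not_nonempty_iff] at h
  have := (W.strategyKernel_mem (Classical.arbitrary A, fun _ => Classical.arbitrary X)).2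
  simp at this

lemma Model.one_sub_errorProb (W : Model A S Se Sd X Y) [Nonempty A] [Nonempty X] {n M : ℕ}
    (hM : 0 < M) (c : Code A Se Sd X Y n M) :
    1 - W.errorProb c = 1 / (M : ℝ) * ∑ m, ∑ ω : Fin n → S × Se × Sd × Y,
      if c.decode (fun i => (decoderView (ω i)).1) (fun i => (decoderView (ω i)).2) = m then
        pathLaw W.strategyKernel (c.strategy m) ω else 0 := by
  have := W.nonempty_path
  have hM' : (M : ℝ) ≠ 0 := by exact_mod_cast hM.ne'
  rw [errorProb_eq, sub_eq_iff_eq_add, ← mul_add, ← Finset.sum_add_distrib]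
  have : ∀ m : Fin M, (∑ ω : Fin n → S × Se × Sd × Y,
      if c.decode (fun i => (decoderView (ω i)).1) (fun i => (decoderView (ω i)).2) = m then
        pathLaw W.strategyKernel (c.strategy m) ω else 0) + (∑ ω : Fin n → S × Se × Sd × Y,
      if c.decode (fun i => (decoderView (ω i)).1) (fun i => (decoderView (ω i)).2) = m then 0
      else pathLaw W.strategyKernel (c.strategy m) ω) = 1 := by
    intro m
    rw [← Finset.sum_add_distrib,
      ← sum_pathLaw (fun t => (W.strategyKernel_mem t).2) (c.isCausal_strategy m)]
    refine Finset.sum_congr rfl fun ω _ => ?_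
    split_ifs <;> simp
  simp [this, hM']

lemma sum_prod_mul_comp {Ω V : Type*} [Fintype Ω] [Fintype V] [DecidableEq V] (ν : Ω → V) {n : ℕ}
    (k : Fin n → Ω → ℝ) (h : (Fin n → V) → ℝ) :
    ∑ ω : Fin n → Ω, (∏ i, k i (ω i)) * h (fun i => ν (ω i)) =
      ∑ v : Fin n → V, (∏ i, pushLaw ν (k i) (v i)) * h v := by
  rw [← sum_pushLaw_mul (fun (ω : Fin n → Ω) i => ν (ω i)) (fun ω => ∏ i, k i (ω i)) h]
  refine Finset.sum_congr rfl fun v _ => ?_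
  simp only [pushLaw]
  rw [← sum_prod_eq_prod_sum fun i x => if ν x = v i then k i x else 0]
  congr 1
  refine Finset.sum_congr rfl fun ω _ => ?_
  rw [Finset.prod_ite_zero]
  simp [funext_iff]

lemma Model.errorProb_strategyCode_le (W : Model A S Se Sd X Y) {n M : ℕ} (hM : 0 < M)
    (x : Fin M → Fin n → A × (Se → X)) (dec : (Fin n → Y × Sd) → Fin M) {ε : ℝ}
    (h : ∀ m, ∑ v, (if dec v = m then 0 else ∏ i, W.strategyChannel (x m i) (v i)) ≤ ε) :
    W.errorProb (strategyCode x dec) ≤ ε := by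
  classical
  have hM' : (M : ℝ) ≠ 0 := by exact_mod_cast hM.ne'
  rw [errorProb_eq]
  have key : ∀ m, (∑ ω : Fin n → S × Se × Sd × Y, if (strategyCode x dec).decode
      (fun i => (decoderView (ω i)).1) (fun i => (decoderView (ω i)).2) = m then 0
      else pathLaw W.strategyKernel ((strategyCode x dec).strategy m) ω) ≤ ε := by
    intro m
    refine le_of_eq_of_le ?_ (h m)
    have := sum_prod_mul_comp decoderView (fun i => W.strategyKernel (x m i))
      fun v => if dec v = m then 0 else 1
    simp only [pushLaw_strategyKernel, mul_ite, mul_zero, mul_one] at this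
    rw [← this]
    refine Finset.sum_congr rfl fun ω _ => ?_
    simp [strategyCode, pathLaw, Code.strategy]
  calc _ ≤ 1 / (M : ℝ) * ∑ _m : Fin M, ε :=
        mul_le_mul_of_nonneg_left (Finset.sum_le_sum fun m _ => key m) (by positivity)
    _ = ε := by simp [hM']

variable [DecidableEq A] [DecidableEq X] [Fintype A] [Fintype X]

lemma Model.information_eq (W : Model A S Se Sd X Y) {U : Type*} [Fintype U] (pU : U → ℝ)
    (g : U → A) (f : U → Se → X) :
    W.information pU g f = channelInfo (fun u => W.strategyChannel (g u, f u)) pU := by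
  rw [← mutualInfo_eq_channelInfo _ fun u => (W.strategyChannel_mem _).2, information]
  congr 1
  funext u v
  rw [Finset.sum_eq_single (g u)]
  · rw [strategyChannel, Finset.mul_sum]
    refine Finset.sum_congr rfl fun s _ => ?_
    rw [Finset.mul_sum]
    refine Finset.sum_congr rfl fun se _ => ?_
    rw [Finset.sum_eq_single (f u se)]
    · simp [jointLaw, strategyKernel]
      ring
    · intro x _ h
      simp [jointLaw, h]
    · simp
  · intro a _ h
    simp [jointLaw, h]
  · simp

lemma Model.expectedCost_eq (W : Model A S Se Sd X Y) (Λ : A → ℝ) {U : Type*} [Fintype U]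
    (pU : U → ℝ) (g : U → A) (f : U → Se → X) :
    W.expectedCost Λ pU g f = ∑ u, pU u * Λ (g u) := by
  refine Finset.sum_congr rfl fun u _ => ?_
  simp only [jointLaw, ← Finset.sum_mul, ← Finset.mul_sum, (W.channel_mem _ _).2,
    Finset.sum_ite_eq', Finset.mem_univ, mul_one, (W.decObs_mem _ _ _).2, (W.encObs_mem _ _).2,
    W.state_mem.2, if_true]
  simp

end Strategies

/-! ### Linear functionals that determine the output law and the cost -/

section InputStateLaw

variable {A S Se Sd X Y : Type*} [Fintype S] [Fintype Se] [Fintype Sd] [Fintype Y]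
  [DecidableEq A] [DecidableEq X]

/-- The laws of `(A, S, S_e, S_d, X)` under the strategies, which determine the cost and, through
`P_{Y|X,S}`, the law of `(Y, S_d)`. -/
def Model.inputStateLaw (W : Model A S Se Sd X Y) (t : A × (Se → X)) (c : A × S × Se × Sd × X) :
    ℝ :=
  if c.1 = t.1 ∧ c.2.2.2.2 = t.2 c.2.2.1 then
    W.state c.2.1 * W.encObs c.2.1 c.1 c.2.2.1 * W.decObs c.2.1 c.2.2.1 c.1 c.2.2.2.1 else 0

variable [Fintype A] [Fintype X]

lemma Model.sum_inputStateLaw_mul (W : Model A S Se Sd X Y)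
    (t : A × (Se → X)) (w : A × S × Se × Sd × X → ℝ) :
    ∑ c, W.inputStateLaw t c * w c = ∑ s, ∑ se, ∑ sd, W.state s * W.encObs s t.1 se *
      W.decObs s se t.1 sd * w (t.1, s, se, sd, t.2 se) := by
  simp only [inputStateLaw, Fintype.sum_prod_type, ite_mul, zero_mul, ite_and]
  rw [Finset.sum_eq_single t.1]
  · simp
  · intro a _ h
    simp [h]
  · simp

lemma Model.strategyChannel_eq (W : Model A S Se Sd X Y) [DecidableEq Sd] (t : A × (Se → X))
    (v : Y × Sd) :
    W.strategyChannel t v = ∑ c, W.inputStateLaw t c *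
      if c.2.2.2.1 = v.2 then W.channel c.2.2.2.2 c.2.1 v.1 else 0 := by
  rw [sum_inputStateLaw_mul]
  simp [strategyChannel, strategyKernel]

lemma Model.cost_eq (W : Model A S Se Sd X Y) (Λ : A → ℝ) (t : A × (Se → X)) :
    Λ t.1 = ∑ c, W.inputStateLaw t c * Λ c.1 := by
  rw [sum_inputStateLaw_mul]
  simp only [← Finset.sum_mul, ← Finset.mul_sum, (W.decObs_mem _ _ _).2, mul_one,
    (W.encObs_mem _ _).2, W.state_mem.2, one_mul]

lemma sum_mul_sum_eq_zero {T κ : Type*} [Fintype T] [Fintype κ] {ℓ : T → κ → ℝ} {d : T → ℝ}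
    (hd : ∀ c, ∑ t, d t * ℓ t c = 0) (w : κ → ℝ) : ∑ t, d t * ∑ c, ℓ t c * w c = 0 := by
  simp only [Finset.mul_sum, ← mul_assoc]
  rw [Finset.sum_comm]
  simp [← Finset.sum_mul, hd]

end InputStateLaw

/-! ### The optimal law of the strategy -/

section Optimum

variable {A S Se Sd X Y : Type*} [Fintype S] [Fintype Se] [Fintype Sd] [Fintype Y]
  [Fintype A] [Fintype X] [DecidableEq Se]

/-- The laws of Shannon strategies whose mean cost is at most `Γ`. -/
def admissibleLaws (Se X : Type*) [Fintype Se] [Fintype X] [DecidableEq Se] (Λ : A → ℝ) (Γ : ℝ) :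
    Set (A × (Se → X) → ℝ) :=
  {p | p ∈ stdSimplex ℝ (A × (Se → X)) ∧ ∑ t, p t * Λ t.1 ≤ Γ}

lemma Model.exists_isMaxOn (W : Model A S Se Sd X Y) (Λ : A → ℝ) (Γ : ℝ) [Nonempty X]
    (hΓ : ∃ a, Λ a ≤ Γ) :
    ∃ p ∈ admissibleLaws Se X Λ Γ,
      IsMaxOn (channelInfo W.strategyChannel) (admissibleLaws Se X Λ Γ) p := by
  classical
  obtain ⟨a, ha⟩ := hΓ
  have hcompact : IsCompact (admissibleLaws Se X Λ Γ) :=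
    (isCompact_stdSimplex (𝕜 := ℝ) (ι := A × (Se → X))).inter_right
      (isClosed_le (f := fun p : A × (Se → X) → ℝ => ∑ t, p t * Λ t.1) (by fun_prop)
        continuous_const)
  refine hcompact.exists_isMaxOn ⟨Pi.single (a, fun _ => Classical.arbitrary X) 1,
    single_mem_stdSimplex ℝ _, ?_⟩ ((continuousOn_channelInfo fun t =>
      (W.strategyChannel_mem t).1).mono fun p hp => hp.1.1)
  simpa [Pi.single_apply] using ha

variable [DecidableEq A] [DecidableEq X]

/-- Alphabets of `U` with `card κ` elements suffice, whenever `card κ` linear functionals `ℓ` of the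
law of the strategy determine the law of `(Y, S_d)` and the cost: with `P_{Y S_d}` fixed, the
information is linear in the law of the strategy. -/
lemma Model.isGreatest_informationValues (W : Model A S Se Sd X Y) {Λ : A → ℝ} {Γ : ℝ}
    {p : A × (Se → X) → ℝ} (hp : p ∈ admissibleLaws Se X Λ Γ)
    (hmax : IsMaxOn (channelInfo W.strategyChannel) (admissibleLaws Se X Λ Γ) p)
    {κ : Type*} [Fintype κ] {N : ℕ} (hN : Fintype.card κ ≤ N) (ℓ : A × (Se → X) → κ → ℝ)
    (hℓ : ∀ d : A × (Se → X) → ℝ, (∀ c, ∑ t, d t * ℓ t c = 0) →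
      ∀ v, ∑ t, d t * W.strategyChannel t v = 0)
    (hcost : (∀ a, Λ a ≤ Γ) ∨ ∀ d : A × (Se → X) → ℝ, (∀ c, ∑ t, d t * ℓ t c = 0) →
      ∑ t, d t * Λ t.1 = 0) :
    IsGreatest (W.informationValues Λ Γ N) (channelInfo W.strategyChannel p) := by
  have hQ : ∀ t, W.strategyChannel t ∈ stdSimplex ℝ (Y × Sd) := W.strategyChannel_mem
  have hQ0 : ∀ t v, 0 ≤ W.strategyChannel t v := fun t => (hQ t).1
  constructor
  · have hℓ1 : ∀ d : A × (Se → X) → ℝ, (∀ c, ∑ t, d t * ℓ t c = 0) → ∑ t, d t = 0 := by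
      intro d hd
      rw [← sum_outputLaw fun t => (hQ t).2]
      exact Finset.sum_eq_zero fun v _ => hℓ d hd v
    obtain ⟨p', hp'0, hp'ℓ, hp'w, hcard⟩ := exists_small_support ℓ
      (fun t => -∑ v, Real.negMulLog (W.strategyChannel t v)) hℓ1 hp.1.1
    have hd : ∀ c, ∑ t, (p' t - p t) * ℓ t c = 0 := by
      intro c
      simp only [sub_mul, Finset.sum_sub_distrib, hp'ℓ c, sub_self]
    have hout : outputLaw W.strategyChannel p' = outputLaw W.strategyChannel p := by
      funext v
      have := hℓ _ hd v
      simp only [sub_mul, Finset.sum_sub_distrib] at this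
      exact sub_eq_zero.1 this
    have hp'1 : ∑ t, p' t = 1 := by
      have := hℓ1 _ hd
      simp only [Finset.sum_sub_distrib, hp.1.2] at this
      linarith
    have hp'c : ∑ t, p' t * Λ t.1 ≤ Γ := by
      rcases hcost with h | h
      · calc ∑ t, p' t * Λ t.1 ≤ ∑ t, p' t * Γ :=
              Finset.sum_le_sum fun t _ => mul_le_mul_of_nonneg_left (h _) (hp'0 t)
          _ = Γ := by rw [← Finset.sum_mul, hp'1, one_mul]
      · have := h _ hd
        simp only [sub_mul, Finset.sum_sub_distrib] at this
        linarith [hp.2]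
    have hp' : p' ∈ admissibleLaws Se X Λ Γ := ⟨⟨hp'0, hp'1⟩, hp'c⟩
    have hinfo : channelInfo W.strategyChannel p' = channelInfo W.strategyChannel p := by
      refine le_antisymm (hmax hp') ?_
      rw [channelInfo_eq_entropy hQ0 hp.1.1, channelInfo_eq_entropy hQ0 hp'0, hout]
      simp only [mul_neg, Finset.sum_neg_distrib] at hp'w
      have := Real.log_pos one_lt_two
      exact div_le_div_of_nonneg_right (by linarith) this.le
    -- the alphabet of `U` is the support of `p'`
    set s := Finset.univ.filter fun t => p' t ≠ 0 with hs
    let e : Fin s.card ≃ s := s.equivFin.symm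
    have hsum : ∀ w : A × (Se → X) → ℝ, ∑ u, p' (e u) * w (e u) = ∑ t, p' t * w t := by
      intro w
      rw [Equiv.sum_comp e fun t => p' t * w t, Finset.sum_coe_sort s fun t => p' t * w t]
      refine Finset.sum_subset (Finset.subset_univ s) fun t _ ht => ?_
      have : p' t = 0 := by simpa [hs] using ht
      simp [this]
    have hpush : pushLaw (fun u => (e u : A × (Se → X))) (fun u => p' (e u)) = p' := by
      funext t
      simpa [pushLaw] using hsum fun t' => if t' = t then 1 else 0
    refine ⟨s.card, hcard.trans hN, fun u => p' (e u), ⟨fun u => hp'0 _, ?_⟩,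
      fun u => (e u : A × (Se → X)).1, fun u => (e u : A × (Se → X)).2, ?_, ?_⟩
    · simpa [hp'1] using hsum 1
    · rw [expectedCost_eq, hsum fun t => Λ t.1]
      exact hp'c
    · rw [information_eq, ← hinfo]
      conv_rhs => rw [← hpush, channelInfo_pushLaw]
  · rintro _ ⟨k, -, pU, hpU, g, f, hc, rfl⟩
    rw [information_eq, ← channelInfo_pushLaw W.strategyChannel fun u => (g u, f u)]
    refine hmax ⟨pushLaw_mem_stdSimplex _ hpU, ?_⟩
    rw [sum_pushLaw_mul]
    rwa [expectedCost_eq] at hc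

end Optimum

/-! ### Capacity -/

section Capacity

variable {A S Se Sd X Y : Type*}

lemma exists_code_meetsCost [Nonempty X] {Λ : A → ℝ} {Γ : ℝ} (hΓ : ∃ a, Λ a ≤ Γ) {M : ℕ}
    (hM : 0 < M) {n : ℕ} (hn : 0 < n) : ∃ c : Code A Se Sd X Y n M, c.MeetsCost Λ Γ := by
  obtain ⟨a, ha⟩ := hΓ
  refine ⟨⟨fun _ _ => a, fun _ _ _ => Classical.arbitrary X, fun _ _ => ⟨0, hM⟩⟩, fun m => ?_⟩
  have hn' : (n : ℝ) ≠ 0 := by exact_mod_cast hn.ne'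
  simpa [hn'] using ha

variable [Fintype S] [Fintype Se] [Fintype Sd] [Fintype Y]

/-- To prove achievability it is enough to find good codes for all large block lengths. -/
lemma Model.achievable_of_eventually (W : Model A S Se Sd X Y) {Λ : A → ℝ} {Γ R : ℝ}
    [Nonempty A] [Nonempty X] {M : ℕ → ℕ} (hM : ∀ n, 0 < M n) {ε : ℕ → ℝ}
    (hε : Tendsto ε atTop (𝓝 0))
    (h : ∀ᶠ n : ℕ in atTop, (2 : ℝ) ^ ((n : ℝ) * R) ≤ (M n : ℝ) ∧
      ∃ c : Code A Se Sd X Y n (M n), c.MeetsCost Λ Γ ∧ W.errorProb c ≤ ε n) :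
    W.Achievable Λ Γ R := by
  classical
  have hex : ∀ n, ∃ c : Code A Se Sd X Y n (M n),
      (∃ c : Code A Se Sd X Y n (M n), c.MeetsCost Λ Γ ∧ W.errorProb c ≤ ε n) →
        c.MeetsCost Λ Γ ∧ W.errorProb c ≤ ε n := by
    intro n
    by_cases hn : ∃ c : Code A Se Sd X Y n (M n), c.MeetsCost Λ Γ ∧ W.errorProb c ≤ ε n
    · exact ⟨hn.choose, fun _ => hn.choose_spec⟩
    · exact ⟨⟨fun _ _ => Classical.arbitrary A, fun _ _ _ => Classical.arbitrary X,
        fun _ _ => ⟨0, hM n⟩⟩, fun h => absurd h hn⟩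
  choose c hc using hex
  refine ⟨M, c, ?_, ?_⟩
  · filter_upwards [h] with n hn using ⟨hn.1, (hc n hn.2).1⟩
  · refine squeeze_zero' (Eventually.of_forall fun n => W.errorProb_nonneg _) ?_ hε
    filter_upwards [h] with n hn using (hc n hn.2).2

lemma Model.achievable_of_nonpos (W : Model A S Se Sd X Y) {Λ : A → ℝ} {Γ R : ℝ}
    [Nonempty X] (hΓ : ∃ a, Λ a ≤ Γ) (hR : R ≤ 0) : W.Achievable Λ Γ R := by
  have : Nonempty A := ⟨hΓ.choose⟩
  refine W.achievable_of_eventually (M := fun _ => 1) (fun _ => one_pos) tendsto_const_nhds ?_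
  filter_upwards [eventually_gt_atTop 0] with n hn
  refine ⟨?_, ?_⟩
  · simpa using Real.rpow_le_one_of_one_le_of_nonpos one_le_two
      (mul_nonpos_of_nonneg_of_nonpos (Nat.cast_nonneg n) hR)
  · obtain ⟨c, hc⟩ := exists_code_meetsCost (Se := Se) (Sd := Sd) (X := X) (Y := Y) hΓ one_pos hn
    refine ⟨c, hc, le_of_eq ?_⟩
    rw [errorProb]
    refine Finset.sum_eq_zero fun m _ => Finset.sum_eq_zero fun s _ =>
      Finset.sum_eq_zero fun se _ => Finset.sum_eq_zero fun sd _ =>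
      Finset.sum_eq_zero fun y _ => if_pos (Subsingleton.elim _ _)

variable [Fintype A] [Fintype X] [DecidableEq Se]

/-- Independent strategies with law `p` give codes of every rate below the information, if the cost
constraint has slack or binds no letter in use. -/
lemma Model.achievable_of_lt (W : Model A S Se Sd X Y) {Λ : A → ℝ} {Γ R : ℝ} [Nonempty X]
    [Nonempty A] {p : A × (Se → X) → ℝ} (hp : p ∈ stdSimplex ℝ (A × (Se → X)))
    (hcost : ∑ t, p t * Λ t.1 < Γ ∨ ∀ t, p t ≠ 0 → Λ t.1 ≤ Γ) (hR0 : 0 ≤ R)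
    (hR : R < channelInfo W.strategyChannel p) : W.Achievable Λ Γ R := by
  obtain ⟨ε, hε, h⟩ := exists_codes hp W.strategyChannel_mem (cost := fun t => Λ t.1) hcost hR0 hR
  have hM : ∀ n : ℕ, 0 < ⌈(2 : ℝ) ^ (n * R)⌉₊ := fun n => Nat.ceil_pos.2 (by positivity)
  refine W.achievable_of_eventually hM hε ?_
  filter_upwards [h, eventually_gt_atTop 0] with n hn hn0
  obtain ⟨x, dec, hx⟩ := hn
  have hn' : (0 : ℝ) < n := by exact_mod_cast hn0
  refine ⟨Nat.le_ceil _, strategyCode x dec, fun m => ?_,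
    W.errorProb_strategyCode_le (hM n) x dec fun m => (hx m).2⟩
  rw [one_div, inv_mul_le_iff₀ hn']
  exact (hx m).1

/-- Mixing in a cheap letter makes the cost constraint slack at a small loss of information; when
there is no letter cheaper than `Γ`, all letters in use cost exactly `Γ`. -/
lemma Model.exists_slack_law (W : Model A S Se Sd X Y) {Λ : A → ℝ} {Γ R : ℝ} [Nonempty X]
    {p : A × (Se → X) → ℝ} (hp : p ∈ admissibleLaws Se X Λ Γ)
    (hR : R < channelInfo W.strategyChannel p) :
    ∃ p' ∈ stdSimplex ℝ (A × (Se → X)),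
      (∑ t, p' t * Λ t.1 < Γ ∨ ∀ t, p' t ≠ 0 → Λ t.1 ≤ Γ) ∧
      R < channelInfo W.strategyChannel p' := by
  classical
  by_cases hcheap : ∃ a, Λ a < Γ
  · obtain ⟨a, ha⟩ := hcheap
    set δ : A × (Se → X) → ℝ := Pi.single (a, fun _ => Classical.arbitrary X) 1 with hδ
    have hδs : δ ∈ stdSimplex ℝ (A × (Se → X)) := single_mem_stdSimplex ℝ _
    have hδc : ∑ t, δ t * Λ t.1 = Λ a := by simp [hδ, Pi.single_apply]
    set γ : ℝ → A × (Se → X) → ℝ := fun r => (1 - r) • p + r • δ with hγ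
    have hγs : ∀ r ∈ Set.Icc (0 : ℝ) 1, γ r ∈ stdSimplex ℝ (A × (Se → X)) := fun r hr =>
      convex_stdSimplex ℝ _ hp.1 hδs (by linarith [hr.2]) hr.1 (by ring)
    have hcont : ContinuousOn (fun r => channelInfo W.strategyChannel (γ r)) (Set.Icc 0 1) :=
      (continuousOn_channelInfo fun t => (W.strategyChannel_mem t).1).comp
        (by fun_prop : Continuous γ).continuousOn fun r hr => (hγs r hr).1
    have h0 : γ 0 = p := by simp [hγ]
    have hev : ∀ᶠ r in 𝓝[>] (0 : ℝ), R < channelInfo W.strategyChannel (γ r) := by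
      have := (hcont 0 ⟨le_rfl, zero_le_one⟩).eventually_const_lt (u := R)
        (by simpa only [h0] using hR)
      rw [← nhdsWithin_Ioc_eq_nhdsGT zero_lt_one]
      exact this.filter_mono (nhdsWithin_mono _ Set.Ioc_subset_Icc_self)
    obtain ⟨r, hr, hr01⟩ := (hev.and (Ioc_mem_nhdsGT zero_lt_one)).exists
    refine ⟨γ r, hγs r ⟨hr01.1.le, hr01.2⟩, Or.inl ?_, hr⟩
    have : ∑ t, γ r t * Λ t.1 = (1 - r) * ∑ t, p t * Λ t.1 + r * ∑ t, δ t * Λ t.1 := by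
      simp only [hγ, Pi.add_apply, Pi.smul_apply, smul_eq_mul, add_mul, Finset.sum_add_distrib,
        Finset.mul_sum, mul_assoc]
    rw [this, hδc]
    have h1 := mul_le_mul_of_nonneg_left hp.2 (sub_nonneg.2 hr01.2)
    have h2 := mul_lt_mul_of_pos_left ha hr01.1
    linarith
  · push Not at hcheap
    refine ⟨p, hp.1, Or.inr fun t ht => ?_, hR⟩
    by_contra! hlt
    have h1 : ∑ t, p t * Γ < ∑ t, p t * Λ t.1 := by
      refine Finset.sum_lt_sum (fun t _ => mul_le_mul_of_nonneg_left (hcheap _) (hp.1.1 t))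
        ⟨t, Finset.mem_univ t, mul_lt_mul_of_pos_left hlt ((hp.1.1 t).lt_of_ne' ht)⟩
    rw [← Finset.sum_mul, hp.1.2, one_mul] at h1
    linarith [hp.2]

/-- The rate of a code with a small probability of error is bounded by the largest information. -/
lemma Model.one_sub_errorProb_mul_log_le (W : Model A S Se Sd X Y) {Λ : A → ℝ} {Γ : ℝ} [Nonempty X]
    [Nonempty A] {p : A × (Se → X) → ℝ}
    (hmax : IsMaxOn (channelInfo W.strategyChannel) (admissibleLaws Se X Λ Γ) p)
    {n M : ℕ} (hn : 0 < n) (hM : 0 < M) (c : Code A Se Sd X Y n M) (hc : c.MeetsCost Λ Γ) :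
    (1 - W.errorProb c) * Real.logb 2 M ≤ n * channelInfo W.strategyChannel p + 1 := by
  classical
  have := W.nonempty_path
  have hn' : (0 : ℝ) < n := by exact_mod_cast hn
  have hlog := correct_mul_log_le W.strategyKernel_mem decoderView hn hM c.isCausal_strategy
    fun v => c.decode (fun i => (v i).1) fun i => (v i).2
  rw [← W.one_sub_errorProb hM] at hlog
  simp only [pushLaw_strategyKernel] at hlog
  have hadm : averageLaw W.strategyKernel c.strategy ∈ admissibleLaws Se X Λ Γ := by
    refine ⟨averageLaw_mem_stdSimplex W.strategyKernel_mem hn hM c.isCausal_strategy,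
      sum_averageLaw_mul_le W.strategyKernel_mem hn hM c.isCausal_strategy fun m ω => ?_⟩
    have := hc m
    rwa [one_div, inv_mul_le_iff₀ hn'] at this
  have := mul_le_mul_of_nonneg_left (hmax hadm) hn'.le
  exact hlog.trans (by simpa using this)

lemma Model.isCausalCapacity (W : Model A S Se Sd X Y) {Λ : A → ℝ} {Γ : ℝ} [Nonempty X]
    (hΓ : ∃ a, Λ a ≤ Γ) {p : A × (Se → X) → ℝ} (hp : p ∈ admissibleLaws Se X Λ Γ)
    (hmax : IsMaxOn (channelInfo W.strategyChannel) (admissibleLaws Se X Λ Γ) p) :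
    W.IsCausalCapacity Λ Γ (channelInfo W.strategyChannel p) := by
  have : Nonempty A := ⟨hΓ.choose⟩
  constructor
  · rintro R ⟨M, c, hMc, herr⟩
    have hl : Tendsto (fun n : ℕ => (1 - W.errorProb (c n)) * R) atTop (𝓝 R) := by
      simpa using (herr.const_sub 1).mul_const R
    have hr : Tendsto (fun n : ℕ => channelInfo W.strategyChannel p + 1 / (n : ℝ)) atTop
        (𝓝 (channelInfo W.strategyChannel p)) := by
      simpa using tendsto_one_div_atTop_nhds_zero_nat.const_add
        (channelInfo W.strategyChannel p)
    refine le_of_tendsto_of_tendsto hl hr ?_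
    filter_upwards [hMc, eventually_gt_atTop 0, herr.eventually_le_const zero_lt_one]
      with n hn hn0 he
    have hn' : (0 : ℝ) < n := by exact_mod_cast hn0
    have hMpos : (0 : ℝ) < M n := (Real.rpow_pos_of_pos two_pos _).trans_le hn.1
    have h1 := W.one_sub_errorProb_mul_log_le hmax hn0 (by exact_mod_cast hMpos) (c n) hn.2
    have h2 : n * R ≤ Real.logb 2 (M n) := (Real.le_logb_iff_rpow_le one_lt_two hMpos).2 hn.1
    have h3 := mul_le_mul_of_nonneg_left h2 (sub_nonneg.2 he)
    have h4 : channelInfo W.strategyChannel p + 1 / (n : ℝ) - (1 - W.errorProb (c n)) * R =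
        (n * channelInfo W.strategyChannel p + 1 - (1 - W.errorProb (c n)) * (n * R)) / n := by
      field_simp
    rw [← sub_nonneg, h4]
    exact div_nonneg (by linarith) hn'.le
  · intro b hb
    refine le_of_forall_lt_imp_le_of_dense fun R hR => ?_
    rcases le_total R 0 with h | h
    · exact hb (W.achievable_of_nonpos hΓ h)
    · obtain ⟨p', hp', hcost, hR'⟩ := W.exists_slack_law hp hR
      exact hb (W.achievable_of_lt hp' hcost h hR')

end Capacity

end Probing

theorem theorem3 {A S Se Sd X Y : Type*}
    [Fintype A] [Fintype S] [Fintype Se] [Fintype Sd] [Fintype X] [Fintype Y]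
    [DecidableEq A] [DecidableEq X] [Nonempty X]
    (W : Probing.Model A S Se Sd X Y) (Λ : A → ℝ) (Γ : ℝ) (hΓ : ∃ a, Λ a ≤ Γ) :
    ∃ C : ℝ, W.IsCausalCapacity Λ Γ C ∧
      IsGreatest (W.informationValues Λ Γ
        (min (Fintype.card Y * Fintype.card Sd + 1)
          (Fintype.card A * Fintype.card S * Fintype.card Se * Fintype.card Sd
            * Fintype.card X + 3))) C ∧
      ((∀ a, Λ a ≤ Γ) →
        IsGreatest (W.informationValues Λ Γ
          (min (Fintype.card Y * Fintype.card Sd)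
            (Fintype.card A * Fintype.card S * Fintype.card Se * Fintype.card Sd
              * Fintype.card X + 3))) C) := by
  classical
  obtain ⟨p, hp, hmax⟩ := W.exists_isMaxOn Λ Γ hΓ
  -- the second bound on the alphabet, from the law of `(A, S, S_e, S_d, X)`
  have hbig : ∀ N, Fintype.card A * Fintype.card S * Fintype.card Se * Fintype.card Sd
      * Fintype.card X + 3 ≤ N →
      IsGreatest (W.informationValues Λ Γ N) (Probing.channelInfo W.strategyChannel p) := by
    intro N hN
    refine W.isGreatest_informationValues hp hmax (κ := A × S × Se × Sd × X) ?_ W.inputStateLaw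
      (fun d hd v => ?_) (Or.inr fun d hd => ?_)
    · simp only [Fintype.card_prod, ← mul_assoc]
      omega
    · simp only [W.strategyChannel_eq]
      exact Probing.sum_mul_sum_eq_zero hd _
    · simp only [W.cost_eq Λ]
      exact Probing.sum_mul_sum_eq_zero hd _
  refine ⟨_, W.isCausalCapacity hΓ hp hmax, ?_, fun hvoid => ?_⟩
  · rcases min_choice (Fintype.card Y * Fintype.card Sd + 1)
      (Fintype.card A * Fintype.card S * Fintype.card Se * Fintype.card Sd
        * Fintype.card X + 3) with h | h
    · rw [h]
      -- the law of `(Y, S_d)`, and the cost in one further coordinate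
      exact W.isGreatest_informationValues hp hmax (κ := Option (Y × Sd)) (by simp)
        (fun t c => c.elim (Λ t.1) (W.strategyChannel t)) (fun d hd v => hd (some v))
        (Or.inr fun d hd => hd none)
    · exact hbig _ h.ge
  · rcases min_choice (Fintype.card Y * Fintype.card Sd)
      (Fintype.card A * Fintype.card S * Fintype.card Se * Fintype.card Sd
        * Fintype.card X + 3) with h | h
    · rw [h]
      exact W.isGreatest_informationValues hp hmax (κ := Y × Sd) (by simp) W.strategyChannel
        (fun d hd => hd) (Or.inl hvoid)
    · exact hbig _ h.ge
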